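/- Let $\mathcal T=\mathrm{Sh}(C,J)$ be a Grothendieck topos, the topos of sheaves of sets on a small site $(C,J)$. Internal notions are understood in the internal logic of $\mathcal T$ (Kripke–Joyal semantics); $\mathbb R$ is the object of Dedekind real numbers and $\mathbb C=\mathbb R\times\mathbb R$. A Banach space object is a $\mathbb C$-module object with a norm valued in bounded positive upper semi-continuous reals (upper cuts of rationals), separated and complete (every internal Cauchy approximation $A_0\supseteq A_1\supseteq\cdots$ of inhabited subsets with $\|x-y\|<\frac1{n+1}$ on $A_n$ converges). (1) Let $X$ be an object of $\mathcal T$ and $B$ a Banach space object of the slice topos $\mathcal T/X$ (for $X=1$: of $\mathcal T$ itself). Let $\Gamma_b(B)$ be the set of global sections $x$ of $B$ for which there is an external constant $K$ with $\|x\|<K$ internally, and let $\|x\|_\infty$ be the infimum of all such $K>0$. Then $\Gamma_b(B)$, with the internal addition, the multiplication by constant complex numbers, and $\|\cdot\|_\infty$, is a complex Banach space. (2) Let $\mathfrak C$ be a small, possibly non-unital, $C^*$-category object of $\mathcal T$ (i.e. an object $|\mathfrak C|$ of $\mathcal T$, a Banach space object over $|\mathfrak C|\times|\mathfrak C|$ of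 morphisms, and bilinear associative submultiplicative composition and an isometric antilinear contravariant involution $*$, with internally $\|h\|^2=\|h^*h\|$ and $h^*h$ positive in the algebra of endomorphisms, that is, of the form $k^*k$ for an endomorphism $k$). A Hilbert $\mathfrak C$-module over $\mathcal T$ is an object $H$ of $\mathcal T/|\mathfrak C|$ which is internally a right Hilbert $\mathfrak C$-module: a $\mathbb C$-linear contravariant functor $a\mapsto H(a)$ with scalar products $\langle y,x\rangle\in\mathfrak C(a,b)$ for $x\in H(a)$, $y\in H(b)$, linear in $x$, with $\langle y,x\rangle=\langle x,y\rangle^*$, $\langle y,xf\rangle=\langle y,x\rangle f$ and $\langle x,x\rangle$ positive, each $H(a)$ being separated and complete for $\|x\|=\|\langle x,x\rangle\|^{1/2}$. A globally bounded operator $f:H\to H'$ is a morphism over $|\mathfrak C|$ that is internally an operator (a bounded $\mathbb C$-linear natural transformation having a bounded adjoint $f^*$: $\langle x,f^*y\rangle=\langle fx,y\rangle$) and for which there is an external constant $K$ such that internally $\|f\|<K$, where $\|f\|=\sup_{a}\|f_a\|$; the infimum of all such $K>0$ is denoted $\|f\|_\infty$. Then Hilbert $\mathfrak C$-modules over $\mathcal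 T$ and globally bounded operators form a (unital) $C^*$-category $\mathcal H_{\mathcal T}\mathfrak C$, for the norm $\|\cdot\|_\infty$ and with addition, complex multiplication and adjunction given by the internal operations: the Hom sets are complex Banach spaces, composition is bilinear with $\|gf\|_\infty\le\|g\|_\infty\|f\|_\infty$, $*$ is an isometric antilinear involutive contravariant functor which is the identity on objects, $\|h\|_\infty^2=\|h^*h\|_\infty$, and $h^*h$ is a positive endomorphism (of the form $k^*k$) for every arrow $h$. The case of Hilbert modules over a $C^*$-algebra object of $\mathcal T$ is the case where $|\mathfrak C|$ is terminal. -/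

import Mathlib

open CategoryTheory Opposite

universe u

namespace ToposHilbert

variable {C : Type u} [SmallCategory C]

/-! ### Local truth (Kripke-Joyal semantics) over a small site -/

/-- `Locally J U P`: the statement `P` holds on all members of some covering sieve of `U`.
This is how disjunctions and existential statements of the internal logic are forced at `U`. -/
def Locally (J : GrothendieckTopology C) (U : C) (P : ∀ ⦃V : C⦄, (V ⟶ U) → Prop) : Prop :=
  ∃ S ∈ J U, ∀ ⦃V : C⦄ (f : V ⟶ U), S.arrows f → P f

section Locally

variable {J : GrothendieckTopology C} {U : C}

theorem Locally.of_forall {P : ∀ ⦃V : C⦄, (V ⟶ U) → Prop} (h : ∀ ⦃V : C⦄ (f : V ⟶ U), P f) :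
    Locally J U P :=
  ⟨⊤, J.top_mem U, fun _ f _ => h f⟩

theorem Locally.mono {P Q : ∀ ⦃V : C⦄, (V ⟶ U) → Prop} (h : Locally J U P)
    (hPQ : ∀ ⦃V : C⦄ (f : V ⟶ U), P f → Q f) : Locally J U Q := by
  obtain ⟨S, hS, hP⟩ := h
  exact ⟨S, hS, fun V f hf => hPQ f (hP f hf)⟩

theorem Locally.and {P Q : ∀ ⦃V : C⦄, (V ⟶ U) → Prop} (h : Locally J U P)
    (h' : Locally J U Q) : Locally J U (fun _ f => P f ∧ Q f) := by
  obtain ⟨S, hS, hP⟩ := h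
  obtain ⟨T, hT, hQ⟩ := h'
  exact ⟨S ⊓ T, J.intersection_covering hS hT, fun V f hf => ⟨hP f hf.1, hQ f hf.2⟩⟩

theorem Locally.pullback {P : ∀ ⦃V : C⦄, (V ⟶ U) → Prop} (h : Locally J U P) {V : C}
    (f : V ⟶ U) : Locally J V (fun _ g => P (g ≫ f)) := by
  obtain ⟨S, hS, hP⟩ := h
  exact ⟨S.pullback f, J.pullback_stable f hS, fun W g hg => hP _ hg⟩

theorem Locally.join {P : ∀ ⦃V : C⦄, (V ⟶ U) → Prop}
    (h : Locally J U (fun V f => Locally J V (fun _ g => P (g ≫ f)))) : Locally J U P := by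
  obtain ⟨S, hS, hP⟩ := h
  let T : Sieve U :=
    { arrows := fun W k => ∀ ⦃Z : C⦄ (m : Z ⟶ W), P (m ≫ k)
      downward_closed := fun {W W'} k hk g Z m => by
        have := hk (m ≫ g)
        simpa using this }
  refine ⟨T, J.transitive hS T ?_, fun V f hf => ?_⟩
  · intro V f hf
    obtain ⟨R, hR, hRP⟩ := hP f hf
    refine J.superset_covering ?_ hR
    intro W g hg Z m
    have := hRP (m ≫ g) (R.downward_closed hg m)
    simpa using this
  · have := hf (𝟙 V)
    simpa using this

theorem Locally.bind {P Q : ∀ ⦃V : C⦄, (V ⟶ U) → Prop} (h : Locally J U P)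
    (hPQ : ∀ ⦃V : C⦄ (f : V ⟶ U), P f → Locally J V (fun _ g => Q (g ≫ f))) :
    Locally J U Q :=
  (h.mono hPQ).join

/-- The sieve on which a statement `P` is forced; it is always closed. -/
def truth (J : GrothendieckTopology C) {U : C} (P : ∀ ⦃V : C⦄, (V ⟶ U) → Prop) : Sieve U where
  arrows V f := Locally J V (fun _ g => P (g ≫ f))
  downward_closed := fun {V W} f hf g => by
    have := Locally.pullback hf g
    simpa using this

theorem truth_closed (P : ∀ ⦃V : C⦄, (V ⟶ U) → Prop) : J.IsClosed (truth J P) := by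
  intro V f hf
  refine Locally.join (P := fun _ g => P (g ≫ f)) ⟨(truth J P).pullback f, hf, fun W g hg => ?_⟩
  have : Locally J W (fun _ k => P (k ≫ (g ≫ f))) := hg
  simpa using this

theorem mem_of_locally {S : Sieve U} (hS : J.IsClosed S) {V : C} (f : V ⟶ U)
    (h : Locally J V (fun _ g => S.arrows (g ≫ f))) : S.arrows f := by
  obtain ⟨R, hR, hRS⟩ := h
  exact hS f (J.superset_covering (fun W g hg => hRS g hg) hR)

end Locally

/-! ### The object of Dedekind real numbers and the object of complex numbers -/

/-- A section over `U` of the object of Dedekind (continuous) real numbers of the topos of sheaves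
on `(C, J)`: a two-sided Dedekind cut of rational numbers in the internal logic. As the object of
rational numbers is a coproduct of copies of the terminal object, each half of the cut is a family
of closed sieves on `U` indexed by `ℚ`; `(lo q).arrows f` says that `q < x` holds after
restriction along `f`, and `(up q).arrows f` that `x < q` does. -/
@[ext]
structure DReal (J : GrothendieckTopology C) (U : C) where
  lo : ℚ → Sieve U
  up : ℚ → Sieve U
  lo_closed : ∀ q, J.IsClosed (lo q)
  up_closed : ∀ q, J.IsClosed (up q)
  lo_inhabited : Locally J U (fun _ f => ∃ q, (lo q).arrows f)
  up_inhabited : Locally J U (fun _ f => ∃ q, (up q).arrows f)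
  lo_rounded : ∀ (q : ℚ) ⦃V : C⦄ (f : V ⟶ U),
    (lo q).arrows f ↔ Locally J V (fun _ g => ∃ q', q < q' ∧ (lo q').arrows (g ≫ f))
  up_rounded : ∀ (q : ℚ) ⦃V : C⦄ (f : V ⟶ U),
    (up q).arrows f ↔ Locally J V (fun _ g => ∃ q', q' < q ∧ (up q').arrows (g ≫ f))
  lo_lt_up : ∀ (q r : ℚ) ⦃V : C⦄ (f : V ⟶ U),
    (lo q).arrows f → (up r).arrows f → Locally J V (fun _ _ => q < r)
  located : ∀ q r : ℚ, q < r → Locally J U (fun _ f => (lo q).arrows f ∨ (up r).arrows f)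

namespace DReal

variable {J : GrothendieckTopology C} {U : C}

theorem lo_mono (x : DReal J U) {q q' : ℚ} (h : q ≤ q') {V : C} {f : V ⟶ U}
    (hf : (x.lo q').arrows f) : (x.lo q).arrows f := by
  rcases h.eq_or_lt with rfl | h
  · exact hf
  · exact (x.lo_rounded q f).2 (.of_forall fun W g => ⟨q', h, (x.lo q').downward_closed hf g⟩)

theorem up_mono (x : DReal J U) {q q' : ℚ} (h : q ≤ q') {V : C} {f : V ⟶ U}
    (hf : (x.up q).arrows f) : (x.up q').arrows f := by
  rcases h.eq_or_lt with rfl | h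
  · exact hf
  · exact (x.up_rounded q' f).2 (.of_forall fun W g => ⟨q, h, (x.up q).downward_closed hf g⟩)

/-- Restriction of a real number along `f : V ⟶ U`. -/
def res {V : C} (f : V ⟶ U) (x : DReal J U) : DReal J V where
  lo q := (x.lo q).pullback f
  up q := (x.up q).pullback f
  lo_closed q := J.isClosed_pullback f _ (x.lo_closed q)
  up_closed q := J.isClosed_pullback f _ (x.up_closed q)
  lo_inhabited := x.lo_inhabited.pullback f
  up_inhabited := x.up_inhabited.pullback f
  lo_rounded q W g := by
    have := x.lo_rounded q (g ≫ f)
    simpa using this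
  up_rounded q W g := by
    have := x.up_rounded q (g ≫ f)
    simpa using this
  lo_lt_up q r W g h h' := x.lo_lt_up q r (g ≫ f) h h'
  located q r h := (x.located q r h).pullback f

/-- The constant real number attached to an external real number. -/
def const (J : GrothendieckTopology C) (U : C) (r : ℝ) : DReal J U where
  lo q := truth J (fun _ _ => (q : ℝ) < r)
  up q := truth J (fun _ _ => r < (q : ℝ))
  lo_closed q := truth_closed _
  up_closed q := truth_closed _
  lo_inhabited := .of_forall fun V f => by
    obtain ⟨q, hq⟩ := exists_rat_lt r
    exact ⟨q, .of_forall fun _ _ => hq⟩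
  up_inhabited := .of_forall fun V f => by
    obtain ⟨q, hq⟩ := exists_rat_gt r
    exact ⟨q, .of_forall fun _ _ => hq⟩
  lo_rounded q V f := by
    constructor
    · intro h
      refine Locally.mono h fun W g hq => ?_
      obtain ⟨q', h1, h2⟩ := exists_rat_btwn hq
      exact ⟨q', by exact_mod_cast h1, .of_forall fun _ _ => h2⟩
    · intro h
      refine Locally.bind (Q := fun _ _ => (q : ℝ) < r) h fun W g ⟨q', h1, h2⟩ => ?_
      exact Locally.mono h2 fun _ _ h3 => lt_trans (by exact_mod_cast h1) h3
  up_rounded q V f := by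
    constructor
    · intro h
      refine Locally.mono h fun W g hq => ?_
      obtain ⟨q', h1, h2⟩ := exists_rat_btwn hq
      exact ⟨q', by exact_mod_cast h2, .of_forall fun _ _ => h1⟩
    · intro h
      refine Locally.bind (Q := fun _ _ => r < (q : ℝ)) h fun W g ⟨q', h1, h2⟩ => ?_
      exact Locally.mono h2 fun _ _ h3 => lt_trans h3 (by exact_mod_cast h1)
  lo_lt_up q r' V f h h' := (Locally.and h h').mono fun W g hg => by
    exact_mod_cast lt_trans hg.1 hg.2
  located q q' h := .of_forall fun V f => by
    rcases lt_or_ge (q : ℝ) r with h1 | h1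
    · exact Or.inl (.of_forall fun _ _ => h1)
    · exact Or.inr (.of_forall fun _ _ => lt_of_le_of_lt h1 (by exact_mod_cast h))

/-- The opposite of a real number. -/
def neg (x : DReal J U) : DReal J U where
  lo q := x.up (-q)
  up q := x.lo (-q)
  lo_closed q := x.up_closed _
  up_closed q := x.lo_closed _
  lo_inhabited := x.up_inhabited.mono fun V f ⟨q, hq⟩ => ⟨-q, by simpa using hq⟩
  up_inhabited := x.lo_inhabited.mono fun V f ⟨q, hq⟩ => ⟨-q, by simpa using hq⟩
  lo_rounded q V f := by
    rw [x.up_rounded]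
    constructor
    · exact fun h => h.mono fun W g ⟨q', h1, h2⟩ => ⟨-q', by linarith, by simpa using h2⟩
    · exact fun h => h.mono fun W g ⟨q', h1, h2⟩ => ⟨-q', by linarith, h2⟩
  up_rounded q V f := by
    rw [x.lo_rounded]
    constructor
    · exact fun h => h.mono fun W g ⟨q', h1, h2⟩ => ⟨-q', by linarith, by simpa using h2⟩
    · exact fun h => h.mono fun W g ⟨q', h1, h2⟩ => ⟨-q', by linarith, h2⟩
  lo_lt_up q r V f h h' := (x.lo_lt_up _ _ f h' h).mono fun W g h => by linarith
  located q r h := (x.located (-r) (-q) (by linarith)).mono fun V f h => h.symm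

/-- A Dedekind real number is, locally, approximated by rational numbers to any precision. -/
theorem exists_approx (x : DReal J U) {ε : ℚ} (hε : 0 < ε) :
    Locally J U (fun _ f => ∃ a b : ℚ, b - a < ε ∧ (x.lo a).arrows f ∧ (x.up b).arrows f) := by
  have key : ∀ (n : ℕ) ⦃V : C⦄ (f : V ⟶ U) (a b : ℚ), b - a < (3 / 2) ^ n * ε →
      (x.lo a).arrows f → (x.up b).arrows f →
      Locally J V (fun _ g => ∃ a b : ℚ, b - a < ε ∧ (x.lo a).arrows (g ≫ f) ∧
        (x.up b).arrows (g ≫ f)) := by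
    intro n
    induction n with
    | zero =>
      intro V f a b h ha hb
      exact .of_forall fun W g => ⟨a, b, by simpa using h,
        (x.lo a).downward_closed ha g, (x.up b).downward_closed hb g⟩
    | succ n ih =>
      intro V f a b h ha hb
      refine (x.lo_lt_up a b f ha hb).bind fun W g hab => ?_
      refine ((x.located (a + (b - a) / 3) (b - (b - a) / 3) (by linarith)).pullback
        (g ≫ f)).bind fun Z k hk => ?_
      rw [pow_succ] at h
      have ha' := (x.lo a).downward_closed ha (k ≫ g)
      have hb' := (x.up b).downward_closed hb (k ≫ g)
      rcases hk with hk | hk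
      · have := ih ((k ≫ g) ≫ f) (a + (b - a) / 3) b (by linarith) (by simpa using hk) hb'
        simpa using this
      · have := ih ((k ≫ g) ≫ f) a (b - (b - a) / 3) (by linarith) ha' (by simpa using hk)
        simpa using this
  refine (x.lo_inhabited.and x.up_inhabited).bind fun V f ⟨⟨a, ha⟩, ⟨b, hb⟩⟩ => ?_
  obtain ⟨n, hn⟩ := pow_unbounded_of_one_lt ((b - a) / ε) (show (1 : ℚ) < 3 / 2 by norm_num)
  exact key n f a b (by rwa [div_lt_iff₀ hε] at hn) ha hb

/-- The sum of two real numbers. -/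
def add (x y : DReal J U) : DReal J U where
  lo q := truth J (fun _ f => ∃ a b : ℚ, q < a + b ∧ (x.lo a).arrows f ∧ (y.lo b).arrows f)
  up q := truth J (fun _ f => ∃ a b : ℚ, a + b < q ∧ (x.up a).arrows f ∧ (y.up b).arrows f)
  lo_closed q := truth_closed _
  up_closed q := truth_closed _
  lo_inhabited := (x.lo_inhabited.and y.lo_inhabited).mono fun V f ⟨⟨a, ha⟩, ⟨b, hb⟩⟩ =>
    ⟨a + b - 1, .of_forall fun W g => ⟨a, b, by linarith,
      (x.lo a).downward_closed ha g, (y.lo b).downward_closed hb g⟩⟩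
  up_inhabited := (x.up_inhabited.and y.up_inhabited).mono fun V f ⟨⟨a, ha⟩, ⟨b, hb⟩⟩ =>
    ⟨a + b + 1, .of_forall fun W g => ⟨a, b, by linarith,
      (x.up a).downward_closed ha g, (y.up b).downward_closed hb g⟩⟩
  lo_rounded q V f := by
    constructor
    · intro h
      refine Locally.mono h fun W g ⟨a, b, h1, h2, h3⟩ => ?_
      refine ⟨(q + (a + b)) / 2, by linarith, .of_forall fun Z k => ⟨a, b, by linarith, ?_, ?_⟩⟩
      · exact (x.lo a).downward_closed h2 k
      · exact (y.lo b).downward_closed h3 k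
    · intro h
      refine Locally.bind (Q := fun _ g => ∃ a b : ℚ, q < a + b ∧ (x.lo a).arrows (g ≫ f) ∧
        (y.lo b).arrows (g ≫ f)) h fun W g ⟨q', h1, h2⟩ => ?_
      exact Locally.mono h2 fun Z k ⟨a, b, h3, h4, h5⟩ =>
        ⟨a, b, by linarith, by simpa using h4, by simpa using h5⟩
  up_rounded q V f := by
    constructor
    · intro h
      refine Locally.mono h fun W g ⟨a, b, h1, h2, h3⟩ => ?_
      refine ⟨(q + (a + b)) / 2, by linarith, .of_forall fun Z k => ⟨a, b, by linarith, ?_, ?_⟩⟩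
      · exact (x.up a).downward_closed h2 k
      · exact (y.up b).downward_closed h3 k
    · intro h
      refine Locally.bind (Q := fun _ g => ∃ a b : ℚ, a + b < q ∧ (x.up a).arrows (g ≫ f) ∧
        (y.up b).arrows (g ≫ f)) h fun W g ⟨q', h1, h2⟩ => ?_
      exact Locally.mono h2 fun Z k ⟨a, b, h3, h4, h5⟩ =>
        ⟨a, b, by linarith, by simpa using h4, by simpa using h5⟩
  lo_lt_up q r V f h h' := by
    refine Locally.bind (Q := fun _ _ => q < r) (Locally.and h h')
      fun W g ⟨⟨a, b, h1, h2, h3⟩, ⟨c, d, h4, h5, h6⟩⟩ => ?_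
    exact ((x.lo_lt_up a c _ h2 h5).and (y.lo_lt_up b d _ h3 h6)).mono
      fun Z k ⟨h7, h8⟩ => by linarith
  located q r h := by
    have hε : 0 < (r - q) / 4 := by linarith
    refine ((x.exists_approx hε).and (y.exists_approx hε)).mono
      fun V f ⟨⟨a, b, h1, h2, h3⟩, ⟨c, d, h4, h5, h6⟩⟩ => ?_
    rcases lt_or_ge q (a + c) with h7 | h7
    · exact Or.inl (.of_forall fun W g => ⟨a, c, h7, (x.lo a).downward_closed h2 g,
        (y.lo c).downward_closed h5 g⟩)
    · exact Or.inr (.of_forall fun W g => ⟨b, d, by linarith, (x.up b).downward_closed h3 g,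
        (y.up d).downward_closed h6 g⟩)

theorem lt_mul_of_corners {q a b c d s t : ℚ} (h1 : a ≤ s) (h2 : s ≤ b) (h3 : c ≤ t) (h4 : t ≤ d)
    (hac : q < a * c) (had : q < a * d) (hbc : q < b * c) (hbd : q < b * d) : q < s * t := by
  have hs : ∀ u : ℚ, q < a * u → q < b * u → q < s * u := by
    intro u ha hb
    rcases le_total 0 u with hu | hu
    · exact lt_of_lt_of_le ha (mul_le_mul_of_nonneg_right h1 hu)
    · exact lt_of_lt_of_le hb (mul_le_mul_of_nonpos_right h2 hu)
  rcases le_total 0 s with hs' | hs'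
  · exact lt_of_lt_of_le (hs c hac hbc) (mul_le_mul_of_nonneg_left h3 hs')
  · exact lt_of_lt_of_le (hs d had hbd) (mul_le_mul_of_nonpos_left h4 hs')

theorem mul_lt_of_corners {q a b c d s t : ℚ} (h1 : a ≤ s) (h2 : s ≤ b) (h3 : c ≤ t) (h4 : t ≤ d)
    (hac : a * c < q) (had : a * d < q) (hbc : b * c < q) (hbd : b * d < q) : s * t < q := by
  have := lt_mul_of_corners (q := -q) (a := -b) (b := -a) (s := -s) (neg_le_neg h2)
    (neg_le_neg h1) h3 h4 (by linarith) (by linarith) (by linarith) (by linarith)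
  linarith

/-- `MulBox x y f P`: some rational box `]a, b[ × ]c, d[` contains `(x, y)` after restriction along
`f`, and all its four corner products satisfy `P`. -/
def MulBox (x y : DReal J U) {V : C} (f : V ⟶ U) (P : ℚ → Prop) : Prop :=
  ∃ a b c d : ℚ, (x.lo a).arrows f ∧ (x.up b).arrows f ∧ (y.lo c).arrows f ∧ (y.up d).arrows f ∧
    P (a * c) ∧ P (a * d) ∧ P (b * c) ∧ P (b * d)

theorem MulBox.restrict {x y : DReal J U} {V : C} {f : V ⟶ U} {P : ℚ → Prop}
    (h : MulBox x y f P) {W : C} (g : W ⟶ V) : MulBox x y (g ≫ f) P := by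
  obtain ⟨a, b, c, d, h1, h2, h3, h4, h5⟩ := h
  exact ⟨a, b, c, d, (x.lo a).downward_closed h1 g, (x.up b).downward_closed h2 g,
    (y.lo c).downward_closed h3 g, (y.up d).downward_closed h4 g, h5⟩

theorem MulBox.imp {x y : DReal J U} {V : C} {f : V ⟶ U} {P Q : ℚ → Prop}
    (h : MulBox x y f P) (hPQ : ∀ t, P t → Q t) : MulBox x y f Q := by
  obtain ⟨a, b, c, d, h1, h2, h3, h4, h5, h6, h7, h8⟩ := h
  exact ⟨a, b, c, d, h1, h2, h3, h4, hPQ _ h5, hPQ _ h6, hPQ _ h7, hPQ _ h8⟩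

theorem MulBox.exists_lt {x y : DReal J U} {V : C} {f : V ⟶ U} {q : ℚ}
    (h : MulBox x y f (fun t => q < t)) : ∃ q', q < q' ∧ MulBox x y f (fun t => q' < t) := by
  obtain ⟨a, b, c, d, h1, h2, h3, h4, h5, h6, h7, h8⟩ := h
  obtain ⟨q', hq, hq'⟩ := exists_between (lt_min (lt_min h5 h6) (lt_min h7 h8))
  simp only [lt_min_iff] at hq'
  exact ⟨q', hq, a, b, c, d, h1, h2, h3, h4, hq'.1.1, hq'.1.2, hq'.2.1, hq'.2.2⟩

theorem MulBox.exists_gt {x y : DReal J U} {V : C} {f : V ⟶ U} {q : ℚ}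
    (h : MulBox x y f (fun t => t < q)) : ∃ q', q' < q ∧ MulBox x y f (fun t => t < q') := by
  obtain ⟨a, b, c, d, h1, h2, h3, h4, h5, h6, h7, h8⟩ := h
  obtain ⟨q', hq, hq'⟩ := exists_between (max_lt (max_lt h5 h6) (max_lt h7 h8))
  simp only [max_lt_iff] at hq
  exact ⟨q', hq', a, b, c, d, h1, h2, h3, h4, hq.1.1, hq.1.2, hq.2.1, hq.2.2⟩

theorem exists_mulBox (x y : DReal J U) :
    Locally J U (fun _ f => ∃ M : ℚ, MulBox x y f (fun t => -M < t ∧ t < M)) := by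
  refine ((x.lo_inhabited.and x.up_inhabited).and (y.lo_inhabited.and y.up_inhabited)).mono
    fun V f ⟨⟨⟨a, ha⟩, ⟨b, hb⟩⟩, ⟨⟨c, hc⟩, ⟨d, hd⟩⟩⟩ => ?_
  have h1 := abs_nonneg (a * c)
  have h2 := abs_nonneg (a * d)
  have h3 := abs_nonneg (b * c)
  have h4 := abs_nonneg (b * d)
  refine ⟨|a * c| + |a * d| + |b * c| + |b * d| + 1, a, b, c, d, ha, hb, hc, hd, ?_, ?_, ?_, ?_⟩ <;>
    refine abs_lt.1 ?_ <;> linarith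

/-- A small box around `(x, y)`, on which the product varies by less than a given amount. -/
theorem exists_mulBox_small (x y : DReal J U) {q r : ℚ} (h : q < r) :
    Locally J U (fun _ f => MulBox x y f (fun t => q < t) ∨ MulBox x y f (fun t => t < r)) := by
  refine ((x.exists_approx one_pos).and (y.exists_approx one_pos)).bind
    fun V f ⟨⟨a₀, b₀, h1, h2, h3⟩, ⟨c₀, d₀, h4, h5, h6⟩⟩ => ?_
  obtain ⟨M, hM⟩ : ∃ M : ℚ, M = |a₀| + |b₀| + |c₀| + |d₀| + 1 := ⟨_, rfl⟩
  have ha₀ := abs_nonneg a₀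
  have hb₀ := abs_nonneg b₀
  have hc₀ := abs_nonneg c₀
  have hd₀ := abs_nonneg d₀
  have hM1 : 1 ≤ M := by linarith
  have hε : 0 < min 1 ((r - q) / (8 * M)) := by
    refine lt_min one_pos (div_pos (by linarith) (by linarith))
  refine (((x.exists_approx hε).and (y.exists_approx hε)).pullback f).bind
    fun W g ⟨⟨a, b, k1, k2, k3⟩, ⟨c, d, k4, k5, k6⟩⟩ => ?_
  have e1 := (x.lo_lt_up a b₀ _ k2 ((x.up b₀).downward_closed h3 g))
  have e2 := (x.lo_lt_up a₀ b _ ((x.lo a₀).downward_closed h2 g) k3)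
  have e3 := (y.lo_lt_up c d₀ _ k5 ((y.up d₀).downward_closed h6 g))
  have e4 := (y.lo_lt_up c₀ d _ ((y.lo c₀).downward_closed h5 g) k6)
  have e5 := (x.lo_lt_up a b _ k2 k3)
  have e6 := (y.lo_lt_up c d _ k5 k6)
  refine ((e1.and e2).and ((e3.and e4).and (e5.and e6))).mono
    fun Z k ⟨⟨m1, m2⟩, ⟨m3, m4⟩, ⟨m5, m6⟩⟩ => ?_
  obtain ⟨k1a, k1b⟩ := lt_min_iff.1 k1
  obtain ⟨k4a, k4b⟩ := lt_min_iff.1 k4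
  rw [lt_div_iff₀ (by linarith)] at k1b k4b
  have A1 := neg_abs_le a₀
  have A2 := le_abs_self b₀
  have A3 := neg_abs_le c₀
  have A4 := le_abs_self d₀
  have ba : |a| ≤ M := abs_le.2 ⟨by linarith, by linarith⟩
  have bb : |b| ≤ M := abs_le.2 ⟨by linarith, by linarith⟩
  have bc : |c| ≤ M := abs_le.2 ⟨by linarith, by linarith⟩
  have bd : |d| ≤ M := abs_le.2 ⟨by linarith, by linarith⟩
  have est : ∀ u v : ℚ, |u| ≤ M → (b - a) * (8 * M) < r - q → |(b - a) * u| < (r - q) / 8 := by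
    intro u _ hu _
    rw [abs_mul, abs_of_pos (by linarith : (0 : ℚ) < b - a)]
    nlinarith [mul_le_mul_of_nonneg_left hu (by linarith : (0 : ℚ) ≤ b - a)]
  have est1 : ∀ u : ℚ, |u| ≤ M → |(b - a) * u| < (r - q) / 8 := fun u hu => est u 0 hu k1b
  have est2 : ∀ u : ℚ, |u| ≤ M → |u * (d - c)| < (r - q) / 8 := by
    intro u hu
    rw [abs_mul, abs_of_pos (by linarith : (0 : ℚ) < d - c)]
    nlinarith [mul_le_mul_of_nonneg_right hu (by linarith : (0 : ℚ) ≤ d - c)]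
  have E1 := abs_lt.1 (est1 c bc)
  have E2 := abs_lt.1 (est1 d bd)
  have E3 := abs_lt.1 (est2 a ba)
  have E4 := abs_lt.1 (est2 b bb)
  have B : ∀ P : ℚ → Prop, P (a * c) → P (a * d) → P (b * c) → P (b * d) →
      MulBox x y (k ≫ g ≫ f) P := fun P p1 p2 p3 p4 =>
    ⟨a, b, c, d, (x.lo a).downward_closed k2 k, (x.up b).downward_closed k3 k,
      (y.lo c).downward_closed k5 k, (y.up d).downward_closed k6 k, p1, p2, p3, p4⟩
  rcases lt_or_ge (a * c) ((q + r) / 2) with hc | hc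
  · refine Or.inr ?_
    have := B (fun t => t < r) (by linarith) (by linarith) (by linarith) (by linarith)
    simpa using this
  · refine Or.inl ?_
    have := B (fun t => q < t) (by linarith) (by linarith) (by linarith) (by linarith)
    simpa using this

/-- The product of two real numbers, computed by interval arithmetic: `q < x y` when `q` is smaller
than all the corner products of some rational box around `(x, y)`, and dually. -/
def mul (x y : DReal J U) : DReal J U where
  lo q := truth J (fun _ f => MulBox x y f (fun t => q < t))
  up q := truth J (fun _ f => MulBox x y f (fun t => t < q))
  lo_closed q := truth_closed _
  up_closed q := truth_closed _
  lo_inhabited := (exists_mulBox x y).mono fun V f ⟨M, hM⟩ =>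
    ⟨-M, .of_forall fun W g => (hM.imp fun t ht => ht.1).restrict g⟩
  up_inhabited := (exists_mulBox x y).mono fun V f ⟨M, hM⟩ =>
    ⟨M, .of_forall fun W g => (hM.imp fun t ht => ht.2).restrict g⟩
  lo_rounded q V f := by
    constructor
    · intro h
      refine Locally.mono h fun W g hg => ?_
      obtain ⟨q', h1, h2⟩ := hg.exists_lt
      exact ⟨q', h1, .of_forall fun Z k => h2.restrict k⟩
    · intro h
      refine Locally.bind (Q := fun _ g => MulBox x y (g ≫ f) (fun t => q < t)) h
        fun W g ⟨q', h1, h2⟩ => ?_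
      refine Locally.mono h2 fun Z k hk => ?_
      have := hk.imp fun t ht => h1.trans ht
      simpa using this
  up_rounded q V f := by
    constructor
    · intro h
      refine Locally.mono h fun W g hg => ?_
      obtain ⟨q', h1, h2⟩ := hg.exists_gt
      exact ⟨q', h1, .of_forall fun Z k => h2.restrict k⟩
    · intro h
      refine Locally.bind (Q := fun _ g => MulBox x y (g ≫ f) (fun t => t < q)) h
        fun W g ⟨q', h1, h2⟩ => ?_
      refine Locally.mono h2 fun Z k hk => ?_
      have := hk.imp fun t ht => lt_trans ht h1
      simpa using this
  lo_lt_up q r V f h h' := by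
    refine Locally.bind (Q := fun _ _ => q < r) (Locally.and h h')
      fun W g ⟨⟨a, b, c, d, a1, a2, a3, a4, p1, p2, p3, p4⟩,
        ⟨a', b', c', d', b1, b2, b3, b4, q1, q2, q3, q4⟩⟩ => ?_
    refine (((x.lo_lt_up a b _ a1 a2).and (x.lo_lt_up a b' _ a1 b2)).and
      ((x.lo_lt_up a' b _ b1 a2).and (x.lo_lt_up a' b' _ b1 b2))).and
      (((y.lo_lt_up c d _ a3 a4).and (y.lo_lt_up c d' _ a3 b4)).and
      ((y.lo_lt_up c' d _ b3 a4).and (y.lo_lt_up c' d' _ b3 b4))) |>.mono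
      fun Z k ⟨⟨⟨m1, m2⟩, m3, m4⟩, ⟨m5, m6⟩, m7, m8⟩ => ?_
    have s1 : max a a' < min b b' := max_lt (lt_min m1 m2) (lt_min m3 m4)
    have t1 : max c c' < min d d' := max_lt (lt_min m5 m6) (lt_min m7 m8)
    exact lt_trans
      (lt_mul_of_corners (le_max_left a a') (s1.le.trans (min_le_left b b'))
        (le_max_left c c') (t1.le.trans (min_le_left d d')) p1 p2 p3 p4)
      (mul_lt_of_corners (le_max_right a a') (s1.le.trans (min_le_right b b'))
        (le_max_right c c') (t1.le.trans (min_le_right d d')) q1 q2 q3 q4)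
  located q r h := (exists_mulBox_small x y h).mono fun V f hf =>
    hf.imp (fun h1 => .of_forall fun W g => h1.restrict g)
      (fun h1 => .of_forall fun W g => h1.restrict g)

end DReal

/-- A section over `U` of the object `ℂ = ℝ × ℝ` of continuous complex numbers. -/
@[ext]
structure DComplex (J : GrothendieckTopology C) (U : C) where
  re : DReal J U
  im : DReal J U

namespace DComplex

variable {J : GrothendieckTopology C} {U : C}

def res {V : C} (f : V ⟶ U) (z : DComplex J U) : DComplex J V := ⟨z.re.res f, z.im.res f⟩

/-- The constant complex number attached to an external complex number. -/
def const (J : GrothendieckTopology C) (U : C) (z : ℂ) : DComplex J U :=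
  ⟨DReal.const J U z.re, DReal.const J U z.im⟩

def add (z w : DComplex J U) : DComplex J U := ⟨z.re.add w.re, z.im.add w.im⟩

def mul (z w : DComplex J U) : DComplex J U :=
  ⟨(z.re.mul w.re).add (z.im.mul w.im).neg, (z.re.mul w.im).add (z.im.mul w.re)⟩

def conj (z : DComplex J U) : DComplex J U := ⟨z.re, z.im.neg⟩

/-- `|z| < r` holds at stage `U`, for a rational number `r`. -/
def AbsLT (z : DComplex J U) (r : ℚ) : Prop :=
  Locally J U (fun _ f => 0 < r ∧ ∃ α β : ℚ, α ^ 2 + β ^ 2 ≤ r ^ 2 ∧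
    (z.re.lo (-α)).arrows f ∧ (z.re.up α).arrows f ∧
    (z.im.lo (-β)).arrows f ∧ (z.im.up β).arrows f)

end DComplex

/-! ### Objects of a slice topos and their fibres -/

variable {J : GrothendieckTopology C}

/-- The sections of the sheaf `F` over `U`. -/
abbrev Sec (F : Sheaf J (Type u)) (U : C) : Type u := F.obj.obj (op U)

/-- Restriction of sections. -/
def res {F : Sheaf J (Type u)} {V U : C} (f : V ⟶ U) (s : Sec F U) : Sec F V := F.obj.map f.op s

theorem res_comp {F : Sheaf J (Type u)} {W V U : C} (g : W ⟶ V) (f : V ⟶ U) (s : Sec F U) :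
    res g (res f s) = res (g ≫ f) s := by
  simp [res]

theorem res_id {F : Sheaf J (Type u)} {U : C} (s : Sec F U) : res (𝟙 U) s = s := by
  simp [res]

/-- The fibre at `x ∈ X(U)` of an object `p : E ⟶ X` of the slice topos over `X`: internally this is
the set `E_x`. -/
def Fib {E X : Sheaf J (Type u)} (p : E ⟶ X) {U : C} (x : Sec X U) : Type u :=
  {e : Sec E U // p.hom.app (op U) e = x}

/-- Restriction along `f : V ⟶ U` of an element of the fibre at `x`; the point `y` is the restriction
of `x`. -/
def Fib.pull {E X : Sheaf J (Type u)} {p : E ⟶ X} {V U : C} (f : V ⟶ U) {x : Sec X U} {y : Sec X V}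
    (h : res f x = y) (e : Fib p x) : Fib p y :=
  ⟨res f e.1, by
    have h1 := NatTrans.naturality_apply p.hom f.op e.1
    have h2 : p.hom.app (op U) e.1 = x := e.2
    rw [h2] at h1
    exact h1.trans h⟩

/-- The product of two sheaves. -/
def prodSheaf (X Y : Sheaf J (Type u)) : Sheaf J (Type u) where
  obj := FunctorToTypes.prod X.obj Y.obj
  property := by
    rw [isSheaf_iff_isSheaf_of_type]
    have hX := (isSheaf_iff_isSheaf_of_type J X.obj).1 X.property
    have hY := (isSheaf_iff_isSheaf_of_type J Y.obj).1 Y.property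
    intro U S hS s hs
    obtain ⟨x, hx, hx'⟩ := hX S hS (fun V f hf => (s f hf).1)
      (fun Y₁ Y₂ Z g₁ g₂ f₁ f₂ h₁ h₂ h => congrArg Prod.fst (hs g₁ g₂ h₁ h₂ h))
    obtain ⟨y, hy, hy'⟩ := hY S hS (fun V f hf => (s f hf).2)
      (fun Y₁ Y₂ Z g₁ g₂ f₁ f₂ h₁ h₂ h => congrArg Prod.snd (hs g₁ g₂ h₁ h₂ h))
    refine ⟨(x, y), fun V f hf => Prod.ext (hx f hf) (hy f hf), fun z hz => ?_⟩
    exact Prod.ext (hx' z.1 fun V f hf => congrArg Prod.fst (hz f hf))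
      (hy' z.2 fun V f hf => congrArg Prod.snd (hz f hf))

/-- A section of the product of two sheaves. -/
def pair {X Y : Sheaf J (Type u)} {U : C} (x : Sec X U) (y : Sec Y U) : Sec (prodSheaf X Y) U :=
  (x, y)

theorem res_pair {X Y : Sheaf J (Type u)} {V U : C} (f : V ⟶ U) (x : Sec X U) (y : Sec Y U) :
    res f (pair x y) = pair (res f x) (res f y) := rfl

/-! ### Internal Banach spaces -/

/-- A `ℂ`-module object in the slice topos over `X` (internally: a family of `ℂ`-modules indexed
by `X`), where `ℂ` is the object of continuous complex numbers. -/
structure ModuleOver (X : Sheaf J (Type u)) where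
  total : Sheaf J (Type u)
  proj : total ⟶ X
  group : ∀ {U : C} (x : Sec X U), AddCommGroup (Fib proj x)
  smul : ∀ {U : C} {x : Sec X U}, DComplex J U → Fib proj x → Fib proj x
  pull_add : ∀ {V U : C} (f : V ⟶ U) {x : Sec X U} (a b : Fib proj x),
    (a + b).pull f rfl = a.pull f rfl + b.pull f rfl
  pull_smul : ∀ {V U : C} (f : V ⟶ U) {x : Sec X U} (z : DComplex J U) (a : Fib proj x),
    (smul z a).pull f rfl = smul (z.res f) (a.pull f rfl)
  one_smul : ∀ {U : C} {x : Sec X U} (a : Fib proj x), smul (DComplex.const J U 1) a = a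
  mul_smul : ∀ {U : C} {x : Sec X U} (z w : DComplex J U) (a : Fib proj x),
    smul (z.mul w) a = smul z (smul w a)
  smul_add : ∀ {U : C} {x : Sec X U} (z : DComplex J U) (a b : Fib proj x),
    smul z (a + b) = smul z a + smul z b
  add_smul : ∀ {U : C} {x : Sec X U} (z w : DComplex J U) (a : Fib proj x),
    smul (z.add w) a = smul z a + smul w a

namespace ModuleOver

attribute [instance] ModuleOver.group

variable {X : Sheaf J (Type u)} (M : ModuleOver X)

/-- The fibre of a module object at `x ∈ X(U)`. -/
abbrev El {U : C} (x : Sec X U) : Type u := Fib M.proj x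

/-- A relation `‖a‖ < q` between sections of `M` and rational numbers. -/
abbrev NormRel : Type u := ∀ ⦃U : C⦄ ⦃x : Sec X U⦄, M.El x → ℚ → Prop

variable {M}

/-- A Cauchy approximation at stage `U` in the fibre `M_x`: internally, a sequence `A₀ ⊇ A₁ ⊇ …` of
inhabited subsets of `M_x` with `‖a - b‖ < 1 / (n + 1)` for all `a, b ∈ A_n`. A subset is a
predicate on sections that is stable under restriction and local. -/
structure CauchyApprox (nlt : M.NormRel) {U : C} (x : Sec X U) where
  mem : ℕ → ∀ ⦃V : C⦄ (f : V ⟶ U), M.El (res f x) → Prop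
  stable : ∀ (n : ℕ) ⦃V W : C⦄ (f : V ⟶ U) (g : W ⟶ V) (a : M.El (res f x)),
    mem n f a → mem n (g ≫ f) (a.pull g (res_comp g f x))
  glue : ∀ (n : ℕ) ⦃V : C⦄ (f : V ⟶ U) (a : M.El (res f x)),
    Locally J V (fun _ g => mem n (g ≫ f) (a.pull g (res_comp g f x))) → mem n f a
  inhabited : ∀ n : ℕ, Locally J U (fun _ f => ∃ a : M.El (res f x), mem n f a)
  anti : ∀ (n : ℕ) ⦃V : C⦄ (f : V ⟶ U) (a : M.El (res f x)), mem (n + 1) f a → mem n f a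
  dist_lt : ∀ (n : ℕ) ⦃V : C⦄ (f : V ⟶ U) (a b : M.El (res f x)),
    mem n f a → mem n f b → nlt (a - b) (1 / ((n : ℚ) + 1))

/-- The Cauchy approximation `A` converges to `l` at the stage `f : V ⟶ U`: internally, every
`a ∈ A_n` satisfies `‖a - l‖ ≤ 1 / (n + 1)`. -/
def CauchyApprox.ConvergesTo {nlt : M.NormRel} {U : C} {x : Sec X U} (A : CauchyApprox nlt x)
    {V : C} (f : V ⟶ U) (l : M.El (res f x)) : Prop :=
  ∀ (n : ℕ) ⦃W : C⦄ (g : W ⟶ V) (a : M.El (res (g ≫ f) x)), A.mem n (g ≫ f) a →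
    ∀ q : ℚ, 1 / ((n : ℚ) + 1) < q → nlt (a - l.pull g (res_comp g f x)) q

/-- Internal completeness of all the fibres: every Cauchy approximation converges. -/
def IsComplete (nlt : M.NormRel) : Prop :=
  ∀ ⦃U : C⦄ (x : Sec X U) (A : CauchyApprox nlt x),
    Locally J U (fun _ f => ∃ l : M.El (res f x), A.ConvergesTo f l)

/-- Internal separation of all the fibres: an element of norm zero is zero. -/
def IsSeparated (nlt : M.NormRel) : Prop :=
  ∀ ⦃U : C⦄ (x : Sec X U) (a : M.El x), (∀ q : ℚ, 0 < q → nlt a q) → a = 0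

end ModuleOver

/-- A Banach space object in the slice topos over `X` (for `X` terminal: in the topos itself). The
norm takes its values in the bounded positive upper semi-continuous real numbers, that is, in upper
cuts of rational numbers; `nlt a q` says that `‖a‖ < q` holds at the stage where `a` lives. -/
structure BanachOver (X : Sheaf J (Type u)) extends ModuleOver X where
  nlt : toModuleOver.NormRel
  nlt_pull : ∀ ⦃V U : C⦄ (f : V ⟶ U) ⦃x : Sec X U⦄ (a : toModuleOver.El x) (q : ℚ),
    nlt a q → nlt (a.pull f rfl) q
  nlt_glue : ∀ ⦃U : C⦄ ⦃x : Sec X U⦄ (a : toModuleOver.El x) (q : ℚ),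
    Locally J U (fun _ f => nlt (a.pull f rfl) q) → nlt a q
  nlt_pos : ∀ ⦃U : C⦄ ⦃x : Sec X U⦄ (a : toModuleOver.El x) (q : ℚ),
    nlt a q → Locally J U (fun _ _ => 0 < q)
  nlt_rounded : ∀ ⦃U : C⦄ ⦃x : Sec X U⦄ (a : toModuleOver.El x) (q : ℚ),
    nlt a q ↔ Locally J U (fun _ f => ∃ q' : ℚ, q' < q ∧ nlt (a.pull f rfl) q')
  nlt_bounded : ∀ ⦃U : C⦄ ⦃x : Sec X U⦄ (a : toModuleOver.El x),
    Locally J U (fun _ f => ∃ q : ℚ, nlt (a.pull f rfl) q)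
  nlt_add : ∀ ⦃U : C⦄ ⦃x : Sec X U⦄ (a b : toModuleOver.El x) (q r : ℚ),
    nlt a q → nlt b r → nlt (a + b) (q + r)
  /-- `‖z a‖ = |z| ‖a‖` -/
  nlt_smul : ∀ ⦃U : C⦄ ⦃x : Sec X U⦄ (z : DComplex J U) (a : toModuleOver.El x) (q : ℚ),
    nlt (smul z a) q ↔ Locally J U (fun _ f => ∃ r s : ℚ, r * s ≤ q ∧
      (z.res f).AbsLT r ∧ nlt (a.pull f rfl) s)
  separated : toModuleOver.IsSeparated nlt
  complete : toModuleOver.IsComplete nlt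

/-- `Γ_b(B)`: the global sections of a Banach space object `B` of the slice topos over `X` (that is,
the morphisms from the terminal object of the slice, `X` itself, to `B`) that are externally
bounded. -/
structure BoundedSection {X : Sheaf J (Type u)} (B : BanachOver X) where
  app : ∀ {U : C} (x : Sec X U), B.El x
  pull_app : ∀ {V U : C} (f : V ⟶ U) (x : Sec X U), (app x).pull f rfl = app (res f x)
  bounded : ∃ K : ℚ, 0 < K ∧ ∀ (U : C) (x : Sec X U), B.nlt (app x) K

/-- `‖s‖_∞`: the infimum of the external bounds of the norm of `s`. -/
noncomputable def BoundedSection.supNorm {X : Sheaf J (Type u)} {B : BanachOver X}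
    (s : BoundedSection B) : ℝ :=
  sInf {K : ℝ | ∃ q : ℚ, (q : ℝ) = K ∧ 0 < q ∧ ∀ (U : C) (x : Sec X U), B.nlt (s.app x) q}

/-! ### Internal `C*`-categories -/

/-- A (small, possibly non-unital) `C*`-category object of the topos of sheaves on `(C, J)`: an
object `Ob` of the topos, and an object of the slice over `Ob × Ob` whose fibre at `(a, b)` is the
Banach space of morphisms from `a` to `b`. -/
structure CStarCategoryObject (J : GrothendieckTopology C) where
  Ob : Sheaf J (Type u)
  mor : BanachOver (prodSheaf Ob Ob)
  /-- `comp g f = g ∘ f` -/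
  comp : ∀ {U : C} {a b c : Sec Ob U}, mor.El (pair b c) → mor.El (pair a b) → mor.El (pair a c)
  comp_pull : ∀ {V U : C} (k : V ⟶ U) {a b c : Sec Ob U} (g : mor.El (pair b c))
    (f : mor.El (pair a b)), (comp g f).pull k (res_pair k a c) =
      comp (g.pull k (res_pair k b c)) (f.pull k (res_pair k a b))
  comp_assoc : ∀ {U : C} {a b c d : Sec Ob U} (h : mor.El (pair c d)) (g : mor.El (pair b c))
    (f : mor.El (pair a b)), comp (comp h g) f = comp h (comp g f)
  add_comp : ∀ {U : C} {a b c : Sec Ob U} (g g' : mor.El (pair b c)) (f : mor.El (pair a b)),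
    comp (g + g') f = comp g f + comp g' f
  comp_add : ∀ {U : C} {a b c : Sec Ob U} (g : mor.El (pair b c)) (f f' : mor.El (pair a b)),
    comp g (f + f') = comp g f + comp g f'
  smul_comp : ∀ {U : C} {a b c : Sec Ob U} (z : DComplex J U) (g : mor.El (pair b c))
    (f : mor.El (pair a b)), comp (mor.smul z g) f = mor.smul z (comp g f)
  comp_smul : ∀ {U : C} {a b c : Sec Ob U} (z : DComplex J U) (g : mor.El (pair b c))
    (f : mor.El (pair a b)), comp g (mor.smul z f) = mor.smul z (comp g f)
  /-- `‖g ∘ f‖ ≤ ‖g‖ ‖f‖` -/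
  nlt_comp : ∀ {U : C} {a b c : Sec Ob U} (g : mor.El (pair b c)) (f : mor.El (pair a b))
    (q r : ℚ), mor.nlt g q → mor.nlt f r → mor.nlt (comp g f) (q * r)
  star : ∀ {U : C} {a b : Sec Ob U}, mor.El (pair a b) → mor.El (pair b a)
  star_pull : ∀ {V U : C} (k : V ⟶ U) {a b : Sec Ob U} (f : mor.El (pair a b)),
    (star f).pull k (res_pair k b a) = star (f.pull k (res_pair k a b))
  star_star : ∀ {U : C} {a b : Sec Ob U} (f : mor.El (pair a b)), star (star f) = f
  star_comp : ∀ {U : C} {a b c : Sec Ob U} (g : mor.El (pair b c)) (f : mor.El (pair a b)),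
    star (comp g f) = comp (star f) (star g)
  star_add : ∀ {U : C} {a b : Sec Ob U} (f g : mor.El (pair a b)), star (f + g) = star f + star g
  star_smul : ∀ {U : C} {a b : Sec Ob U} (z : DComplex J U) (f : mor.El (pair a b)),
    star (mor.smul z f) = mor.smul z.conj (star f)
  /-- `‖f^*‖ = ‖f‖` -/
  nlt_star : ∀ {U : C} {a b : Sec Ob U} (f : mor.El (pair a b)) (q : ℚ),
    mor.nlt (star f) q ↔ mor.nlt f q
  /-- `‖h^* h‖ = ‖h‖ ^ 2` -/
  nlt_star_comp_self : ∀ {U : C} {a b : Sec Ob U} (h : mor.El (pair a b)) (q : ℚ), 0 < q →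
    (mor.nlt (comp (star h) h) (q ^ 2) ↔ mor.nlt h q)
  /-- `h^* h` is internally a positive element `k^* k` of the `C*`-algebra of endomorphisms -/
  star_comp_self_pos : ∀ {U : C} {a b : Sec Ob U} (h : mor.El (pair a b)),
    Locally J U (fun _ f => ∃ k : mor.El (pair (res f a) (res f a)),
      (comp (star h) h).pull f (res_pair f a a) = comp (star k) k)

namespace CStarCategoryObject

variable (𝔄 : CStarCategoryObject J)

/-- The morphisms of `𝔄` from `a` to `b` at stage `U`. -/
abbrev Mor {U : C} (a b : Sec 𝔄.Ob U) : Type u := 𝔄.mor.El (pair a b)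

variable {𝔄}

/-- Restriction of morphisms. -/
def Mor.restrict {V U : C} (f : V ⟶ U) {a b : Sec 𝔄.Ob U} (m : 𝔄.Mor a b) :
    𝔄.Mor (res f a) (res f b) :=
  Fib.pull f (res_pair f a b) m

/-- Internal positivity of an endomorphism: it is, locally, of the form `k^* k`. -/
def IsPositive {U : C} {a : Sec 𝔄.Ob U} (t : 𝔄.Mor a a) : Prop :=
  Locally J U (fun _ f => ∃ k : 𝔄.Mor (res f a) (res f a),
    Mor.restrict f t = 𝔄.comp (𝔄.star k) k)

end CStarCategoryObject

/-! ### Hilbert modules over the topos -/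

open CStarCategoryObject in
/-- A right pre-Hilbert `𝔄`-module over the topos: an object of the slice over the object `𝔄.Ob` of
objects of `𝔄`, which is internally a `ℂ`-linear contravariant functor on `𝔄` with a
sesquilinear, `𝔄`-valued and positive scalar product. -/
structure PreHilbertModule (𝔄 : CStarCategoryObject J) extends ModuleOver 𝔄.Ob where
  act : ∀ {U : C} {a b : Sec 𝔄.Ob U}, toModuleOver.El a → 𝔄.Mor b a → toModuleOver.El b
  act_pull : ∀ {V U : C} (k : V ⟶ U) {a b : Sec 𝔄.Ob U} (x : toModuleOver.El a) (f : 𝔄.Mor b a),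
    (act x f).pull k rfl = act (x.pull k rfl) (Mor.restrict k f)
  act_comp : ∀ {U : C} {a b c : Sec 𝔄.Ob U} (x : toModuleOver.El a) (f : 𝔄.Mor b a)
    (g : 𝔄.Mor c b), act x (𝔄.comp f g) = act (act x f) g
  add_act : ∀ {U : C} {a b : Sec 𝔄.Ob U} (x y : toModuleOver.El a) (f : 𝔄.Mor b a),
    act (x + y) f = act x f + act y f
  act_add : ∀ {U : C} {a b : Sec 𝔄.Ob U} (x : toModuleOver.El a) (f g : 𝔄.Mor b a),
    act x (f + g) = act x f + act x g
  smul_act : ∀ {U : C} {a b : Sec 𝔄.Ob U} (z : DComplex J U) (x : toModuleOver.El a)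
    (f : 𝔄.Mor b a), act (smul z x) f = smul z (act x f)
  act_smul : ∀ {U : C} {a b : Sec 𝔄.Ob U} (z : DComplex J U) (x : toModuleOver.El a)
    (f : 𝔄.Mor b a), act x (𝔄.mor.smul z f) = smul z (act x f)
  /-- the scalar product `⟨y, x⟩`, a morphism from `a` to `b` for `y` over `b` and `x` over `a` -/
  inner : ∀ {U : C} {a b : Sec 𝔄.Ob U}, toModuleOver.El b → toModuleOver.El a → 𝔄.Mor a b
  inner_pull : ∀ {V U : C} (k : V ⟶ U) {a b : Sec 𝔄.Ob U} (y : toModuleOver.El b)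
    (x : toModuleOver.El a), Mor.restrict k (inner y x) = inner (y.pull k rfl) (x.pull k rfl)
  inner_symm : ∀ {U : C} {a b : Sec 𝔄.Ob U} (y : toModuleOver.El b) (x : toModuleOver.El a),
    inner y x = 𝔄.star (inner x y)
  inner_add : ∀ {U : C} {a b : Sec 𝔄.Ob U} (y : toModuleOver.El b) (x x' : toModuleOver.El a),
    inner y (x + x') = inner y x + inner y x'
  inner_smul : ∀ {U : C} {a b : Sec 𝔄.Ob U} (z : DComplex J U) (y : toModuleOver.El b)
    (x : toModuleOver.El a), inner y (smul z x) = 𝔄.mor.smul z (inner y x)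
  inner_act : ∀ {U : C} {a b c : Sec 𝔄.Ob U} (y : toModuleOver.El b) (x : toModuleOver.El a)
    (f : 𝔄.Mor c a), inner y (act x f) = 𝔄.comp (inner y x) f
  inner_self_pos : ∀ {U : C} {a : Sec 𝔄.Ob U} (x : toModuleOver.El a), IsPositive (inner x x)

/-- `‖x‖ < q` where `‖x‖ = ‖⟨x, x⟩‖ ^ (1 / 2)`. -/
def PreHilbertModule.nlt {𝔄 : CStarCategoryObject J} (H : PreHilbertModule 𝔄) :
    H.toModuleOver.NormRel :=
  fun U _ x q => Locally J U (fun _ _ => 0 < q) ∧ 𝔄.mor.nlt (H.inner x x) (q ^ 2)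

/-- A Hilbert `𝔄`-module over the topos: a pre-Hilbert module that is internally separated and
complete. -/
structure HilbertModule (𝔄 : CStarCategoryObject J) extends PreHilbertModule 𝔄 where
  separated : toModuleOver.IsSeparated toPreHilbertModule.nlt
  complete : toModuleOver.IsComplete toPreHilbertModule.nlt

variable {𝔄 : CStarCategoryObject J}

/-- A morphism of the topos that is internally a `ℂ`-linear natural transformation. -/
structure NatMap (H G : HilbertModule 𝔄) where
  app : ∀ {U : C} {a : Sec 𝔄.Ob U}, H.El a → G.El a
  app_pull : ∀ {V U : C} (k : V ⟶ U) {a : Sec 𝔄.Ob U} (x : H.El a),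
    (app x).pull k rfl = app (x.pull k rfl)
  app_add : ∀ {U : C} {a : Sec 𝔄.Ob U} (x y : H.El a), app (x + y) = app x + app y
  app_smul : ∀ {U : C} {a : Sec 𝔄.Ob U} (z : DComplex J U) (x : H.El a),
    app (H.smul z x) = G.smul z (app x)
  app_act : ∀ {U : C} {a b : Sec 𝔄.Ob U} (x : H.El a) (f : 𝔄.Mor b a),
    app (H.act x f) = G.act (app x) f

namespace NatMap

variable {H G K : HilbertModule 𝔄}

/-- At stage `U`: `‖f(x)‖ ≤ k ‖x‖` for all objects `a` of `𝔄` and all `x ∈ H(a)`. -/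
def BoundedBy (f : NatMap H G) (U : C) (k : ℚ) : Prop :=
  ∀ ⦃V : C⦄ (_ : V ⟶ U) ⦃a : Sec 𝔄.Ob V⦄ (x : H.El a) (r : ℚ), H.nlt x r → G.nlt (f.app x) (k * r)

/-- At stage `U`: `‖f‖ < q`, where `‖f‖` is the internal operator norm, the supremum over the
objects `a` of `𝔄` of the norms of the maps `H(a) → G(a)`, an upper semi-continuous number. -/
def NormLT (f : NatMap H G) (U : C) (q : ℚ) : Prop :=
  Locally J U (fun V _ => ∃ k : ℚ, 0 < k ∧ k < q ∧ f.BoundedBy V k)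

/-- Internal boundedness. -/
def IsBounded (f : NatMap H G) : Prop :=
  ∀ U : C, Locally J U (fun V _ => ∃ q : ℚ, f.NormLT V q)

/-- The identity. -/
def id (H : HilbertModule 𝔄) : NatMap H H where
  app x := x
  app_pull _ _ _ := rfl
  app_add _ _ := rfl
  app_smul _ _ := rfl
  app_act _ _ := rfl

/-- Composition. -/
def comp (g : NatMap G K) (f : NatMap H G) : NatMap H K where
  app x := g.app (f.app x)
  app_pull k _ x := by rw [g.app_pull, f.app_pull]
  app_add x y := by rw [f.app_add, g.app_add]
  app_smul z x := by rw [f.app_smul, g.app_smul]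
  app_act x m := by rw [f.app_act, g.app_act]

theorem normLT_id (U : C) : (NatMap.id H).NormLT U 2 :=
  .of_forall fun _ _ => ⟨1, one_pos, one_lt_two, fun _ _ _ x r h => by rwa [one_mul]⟩

theorem normLT_comp {g : NatMap G K} {f : NatMap H G} {U : C} {q r : ℚ} (hg : g.NormLT U q)
    (hf : f.NormLT U r) : (g.comp f).NormLT U (q * r) := by
  refine (Locally.and hg hf).mono fun V k ⟨⟨a, a1, a2, a3⟩, ⟨b, b1, b2, b3⟩⟩ => ?_
  refine ⟨a * b, mul_pos a1 b1, mul_lt_mul'' a2 b2 a1.le b1.le, fun W m c x s hs => ?_⟩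
  rw [mul_assoc]
  exact a3 m _ _ (b3 m _ _ hs)

theorem isBounded_comp {g : NatMap G K} {f : NatMap H G} (hg : g.IsBounded) (hf : f.IsBounded) :
    (g.comp f).IsBounded := fun U =>
  (Locally.and (hg U) (hf U)).mono fun _ _ ⟨⟨q, hq⟩, ⟨r, hr⟩⟩ => ⟨q * r, normLT_comp hq hr⟩

end NatMap

/-- A globally bounded operator from `H` to `G`: a morphism `f` of the topos which is internally
an operator, i.e. a pair `(f, f^*)` of bounded `ℂ`-linear natural transformations that are adjoint
to each other, and whose norm is bounded by an external constant. -/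
structure GlobalOperator (H G : HilbertModule 𝔄) where
  toMap : NatMap H G
  adj : NatMap G H
  isBounded : toMap.IsBounded
  adj_isBounded : adj.IsBounded
  inner_adj : ∀ {U : C} {a b : Sec 𝔄.Ob U} (x : H.El a) (y : G.El b),
    H.inner x (adj.app y) = G.inner (toMap.app x) y
  globallyBounded : ∃ q : ℚ, 0 < q ∧ ∀ U : C, toMap.NormLT U q

/-- `‖f‖_∞`: the infimum of the external constants `q` such that `‖f‖ < q` internally. -/
noncomputable def GlobalOperator.supNorm {H G : HilbertModule 𝔄} (f : GlobalOperator H G) : ℝ :=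
  sInf {K : ℝ | ∃ q : ℚ, (q : ℝ) = K ∧ 0 < q ∧ ∀ U : C, f.toMap.NormLT U q}

/-- The category of Hilbert `𝔄`-modules over the topos and globally bounded operators. -/
instance : Category (HilbertModule 𝔄) where
  Hom := GlobalOperator
  id H :=
    { toMap := NatMap.id H
      adj := NatMap.id H
      isBounded := fun _ => .of_forall fun V _ => ⟨2, NatMap.normLT_id V⟩
      adj_isBounded := fun _ => .of_forall fun V _ => ⟨2, NatMap.normLT_id V⟩
      inner_adj := fun _ _ => rfl
      globallyBounded := ⟨2, two_pos, NatMap.normLT_id⟩ }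
  comp f g :=
    { toMap := g.toMap.comp f.toMap
      adj := f.adj.comp g.adj
      isBounded := NatMap.isBounded_comp g.isBounded f.isBounded
      adj_isBounded := NatMap.isBounded_comp f.adj_isBounded g.adj_isBounded
      inner_adj := fun x y => (f.inner_adj x (g.adj.app y)).trans (g.inner_adj (f.toMap.app x) y)
      globallyBounded := by
        obtain ⟨q, hq, hq'⟩ := g.globallyBounded
        obtain ⟨r, hr, hr'⟩ := f.globallyBounded
        exact ⟨q * r, mul_pos hq hr, fun U => NatMap.normLT_comp (hq' U) (hr' U)⟩ }

/-- An arrow of the category of Hilbert modules, seen as a globally bounded operator. -/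
abbrev toOperator {H G : HilbertModule 𝔄} (f : H ⟶ G) : GlobalOperator H G := f

/-! ### External `C*`-categories -/

/-- The structure of a (unital) `C*`-category on a category `A`. -/
class CStarCategory (A : Type*) [Category A] where
  normedAddCommGroup : ∀ X Y : A, NormedAddCommGroup (X ⟶ Y)
  normedSpace : ∀ X Y : A, NormedSpace ℂ (X ⟶ Y)
  completeSpace : ∀ X Y : A, CompleteSpace (X ⟶ Y)
  add_comp : ∀ {X Y Z : A} (f f' : X ⟶ Y) (g : Y ⟶ Z), (f + f') ≫ g = f ≫ g + f' ≫ g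
  comp_add : ∀ {X Y Z : A} (f : X ⟶ Y) (g g' : Y ⟶ Z), f ≫ (g + g') = f ≫ g + f ≫ g'
  smul_comp : ∀ {X Y Z : A} (z : ℂ) (f : X ⟶ Y) (g : Y ⟶ Z), (z • f) ≫ g = z • (f ≫ g)
  comp_smul : ∀ {X Y Z : A} (z : ℂ) (f : X ⟶ Y) (g : Y ⟶ Z), f ≫ (z • g) = z • (f ≫ g)
  norm_comp_le : ∀ {X Y Z : A} (f : X ⟶ Y) (g : Y ⟶ Z), ‖f ≫ g‖ ≤ ‖g‖ * ‖f‖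
  dagger : ∀ {X Y : A}, (X ⟶ Y) → (Y ⟶ X)
  dagger_dagger : ∀ {X Y : A} (f : X ⟶ Y), dagger (dagger f) = f
  dagger_id : ∀ X : A, dagger (𝟙 X) = 𝟙 X
  dagger_comp : ∀ {X Y Z : A} (f : X ⟶ Y) (g : Y ⟶ Z), dagger (f ≫ g) = dagger g ≫ dagger f
  dagger_add : ∀ {X Y : A} (f g : X ⟶ Y), dagger (f + g) = dagger f + dagger g
  dagger_smul : ∀ {X Y : A} (z : ℂ) (f : X ⟶ Y),
    dagger (z • f) = (starRingEnd ℂ) z • dagger f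
  norm_dagger : ∀ {X Y : A} (f : X ⟶ Y), ‖dagger f‖ = ‖f‖
  /-- the `C*`-identity `‖h‖ ^ 2 = ‖h^* h‖` -/
  norm_comp_dagger : ∀ {X Y : A} (h : X ⟶ Y), ‖h‖ ^ 2 = ‖h ≫ dagger h‖
  /-- `h^* h` is a positive element of the `C*`-algebra of endomorphisms of `X` -/
  comp_dagger_pos : ∀ {X Y : A} (h : X ⟶ Y), ∃ k : X ⟶ X, h ≫ dagger h = k ≫ dagger k

attribute [reducible, instance] CStarCategory.normedAddCommGroup CStarCategory.normedSpace

attribute [instance] CStarCategory.completeSpace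

end ToposHilbert

open ToposHilbert

/-! Each norm in play is an upper cut, that is, a relation `‖a‖ < q` with rational `q`. `IsRatGauge`
lists what such a relation must satisfy for the infimum of its bounds to be a complete norm. It is
verified three times: for bounded sections, for the endomorphisms of an object of `𝔄` that are
bounded at a stage (`EndAlg`), and for globally bounded operators.

Completeness. The tails of an external Cauchy sequence form an internal Cauchy approximation, which
converges on some cover. Separation makes the local limits unique, so they glue (`exists_locLim`). A
uniform Cauchy rate survives the passage to the limit (`LocLim.nlt_sub`), so convergence is uniform
over all stages and the limit is externally bounded.

Positivity and Cauchy-Schwarz. Internal positivity only provides `t = k^* k` on a cover, with a `k`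
that is not unique and need not glue. In a `C*`-algebra, however, a self-adjoint `t` is positive as
soon as `s t s = -c^* c` with `s` self-adjoint forces `c = 0` (take for `s` the negative part of
`t`). The conclusion `c = 0` is an equation, so it may be checked on a cover. Hence internal
positivity implies positivity in the external `C*`-algebra `EndAlg a`, where the spectral order is
available; expanding `⟨x - y d, x - y d⟩ ≥ 0` there gives Cauchy-Schwarz (`nlt_inner`), and the
triangle inequality on Hilbert modules follows.

Operators. Cauchy-Schwarz gives `‖f^*‖ ≤ ‖f‖` and `‖f‖ ^ 2 ≤ ‖f^* f‖`. For an operator-norm Cauchy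
sequence both the operators and their adjoints converge, and the limits are again adjoint
(`isAdjoint_of_tendsTo`). The endomorphisms of `H` thus form a `C*`-algebra, to which the same
positivity criterion applies: if `s h^* h s = -c^* c`, then `⟨h s x, h s x⟩ + ⟨c x, c x⟩ = 0` is a
sum of positive elements of `𝔄`, so `c = 0`. -/

namespace ToposHilbert

/-! ### Norms given by rational upper cuts -/

/-- A norm on a complex vector space presented by the relation `‖a‖ < q` for rational `q`. -/
structure IsRatGauge {E : Type*} [AddCommGroup E] [Module ℂ E] (lt : E → ℚ → Prop) : Prop where
  bounded : ∀ a, ∃ q, 0 < q ∧ lt a q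
  mono : ∀ ⦃a q r⦄, 0 < q → q ≤ r → lt a q → lt a r
  add : ∀ ⦃a b q r⦄, 0 < q → 0 < r → lt a q → lt b r → lt (a + b) (q + r)
  smul : ∀ ⦃z : ℂ⦄ ⦃r : ℚ⦄ ⦃a q⦄, ‖z‖ < r → 0 < q → lt a q → lt (z • a) (r * q)
  separated : ∀ ⦃a⦄, (∀ q, 0 < q → lt a q) → a = 0
  complete : ∀ s : ℕ → E, (∀ ε, 0 < ε → ∃ N, ∀ n m, N ≤ n → N ≤ m → lt (s n - s m) ε) →
    ∃ l, ∀ ε, 0 < ε → ∃ N, ∀ n, N ≤ n → lt (s n - l) ε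

/-- The norm defined by a relation `‖a‖ < q`. -/
noncomputable def gaugeNorm {E : Type*} (lt : E → ℚ → Prop) (a : E) : ℝ :=
  sInf {K : ℝ | ∃ q : ℚ, (q : ℝ) = K ∧ 0 < q ∧ lt a q}

section Gauge

variable {E F : Type*} {lt : E → ℚ → Prop} {lt' : F → ℚ → Prop}

theorem gaugeNorm_nonneg (a : E) : 0 ≤ gaugeNorm lt a :=
  Real.sInf_nonneg (by rintro _ ⟨q, rfl, hq, -⟩; exact_mod_cast hq.le)

theorem gaugeNorm_le {a : E} {q : ℚ} (hq : 0 < q) (h : lt a q) : gaugeNorm lt a ≤ q :=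
  csInf_le ⟨0, by rintro _ ⟨q, rfl, hq, -⟩; exact_mod_cast hq.le⟩ ⟨q, rfl, hq, h⟩

theorem le_mul_of_forall_rat {x a b : ℝ} (ha : 0 ≤ a) (hb : 0 ≤ b)
    (h : ∀ q r : ℚ, a < q → b < r → x ≤ q * r) : x ≤ a * b := by
  refine le_mul_of_forall_lt₀ fun a' ha' b' hb' => ?_
  obtain ⟨q, q1, q2⟩ := exists_rat_btwn ha'
  obtain ⟨r, r1, r2⟩ := exists_rat_btwn hb'
  exact (h q r q1 r1).trans
    (mul_le_mul q2.le r2.le (hb.trans r1.le) ((ha.trans q1.le).trans q2.le))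

namespace IsRatGauge

variable [AddCommGroup E] [Module ℂ E]

theorem lt_of_gaugeNorm_lt (h : IsRatGauge lt) {a : E} {q : ℚ} (hq : gaugeNorm lt a < q) :
    lt a q := by
  obtain ⟨q₀, h0, h1⟩ := h.bounded a
  obtain ⟨_, ⟨r, rfl, hr, hr'⟩, hrq⟩ := exists_lt_of_csInf_lt
    (show {K : ℝ | ∃ q : ℚ, (q : ℝ) = K ∧ 0 < q ∧ lt a q}.Nonempty from ⟨q₀, q₀, rfl, h0, h1⟩) hq
  exact h.mono hr (by exact_mod_cast hrq.le) hr'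

theorem smul_le (h : IsRatGauge lt) (z : ℂ) (a : E) :
    gaugeNorm lt (z • a) ≤ ‖z‖ * gaugeNorm lt a := by
  refine le_mul_of_forall_rat (norm_nonneg z) (gaugeNorm_nonneg a) fun q r hq hr => ?_
  have hq0 : 0 < q := by exact_mod_cast (norm_nonneg z).trans_lt hq
  have hr0 : 0 < r := by exact_mod_cast (gaugeNorm_nonneg a).trans_lt hr
  exact_mod_cast gaugeNorm_le (mul_pos hq0 hr0) (h.smul hq hr0 (h.lt_of_gaugeNorm_lt hr))

theorem core (h : IsRatGauge lt) :
    letI : Norm E := ⟨gaugeNorm lt⟩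
    NormedSpace.Core ℂ E :=
  letI : Norm E := ⟨gaugeNorm lt⟩
  { norm_nonneg := gaugeNorm_nonneg
    norm_smul := fun z a => by
      refine le_antisymm (h.smul_le z a) ?_
      rcases eq_or_ne z 0 with rfl | hz
      · simpa using gaugeNorm_nonneg _
      -- A gauge only gives `‖z a‖ ≤ |z| ‖a‖`; the reverse inequality is the same one applied to
      -- `z⁻¹` and `z a`.
      · have h1 := h.smul_le z⁻¹ (z • a)
        rw [smul_smul, inv_mul_cancel₀ hz, one_smul, norm_inv] at h1
        have hz' := norm_pos_iff.2 hz
        rwa [inv_mul_eq_div, le_div_iff₀' hz'] at h1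
    norm_triangle := fun a b => by
      refine le_of_forall_pos_lt_add fun ε hε => ?_
      obtain ⟨q, q1, q2⟩ := exists_rat_btwn
        (show gaugeNorm lt a < gaugeNorm lt a + ε / 2 by linarith)
      obtain ⟨r, r1, r2⟩ := exists_rat_btwn
        (show gaugeNorm lt b < gaugeNorm lt b + ε / 2 by linarith)
      have hq0 : 0 < q := by exact_mod_cast (gaugeNorm_nonneg a).trans_lt q1
      have hr0 : 0 < r := by exact_mod_cast (gaugeNorm_nonneg b).trans_lt r1
      have := gaugeNorm_le (add_pos hq0 hr0)
        (h.add hq0 hr0 (h.lt_of_gaugeNorm_lt q1) (h.lt_of_gaugeNorm_lt r1))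
      push_cast at this
      change gaugeNorm lt (a + b) < gaugeNorm lt a + gaugeNorm lt b + ε
      linarith
    norm_eq_zero_iff := fun a => by
      change gaugeNorm lt a = 0 ↔ a = 0
      constructor
      · exact fun h0 => h.separated fun q hq =>
          h.lt_of_gaugeNorm_lt (by rw [h0]; exact_mod_cast hq)
      · rintro rfl
        have := h.smul_le 0 (0 : E)
        rw [zero_smul, norm_zero, zero_mul] at this
        exact le_antisymm this (gaugeNorm_nonneg _) }

/-- The normed group defined by a rational gauge. -/
@[reducible] noncomputable def normedAddCommGroup (h : IsRatGauge lt) : NormedAddCommGroup E :=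
  letI : Norm E := ⟨gaugeNorm lt⟩
  NormedAddCommGroup.ofCore h.core

/-- The normed space defined by a rational gauge. -/
@[reducible] noncomputable def normedSpace (h : IsRatGauge lt) :
    letI := h.normedAddCommGroup
    NormedSpace ℂ E :=
  letI := h.normedAddCommGroup
  { norm_smul_le := h.smul_le }

theorem completeSpace (h : IsRatGauge lt) :
    letI := h.normedAddCommGroup
    CompleteSpace E := by
  let _ := h.normedAddCommGroup
  have hn : ∀ a : E, ‖a‖ = gaugeNorm lt a := fun _ => rfl
  refine Metric.complete_of_cauchySeq_tendsto fun s hs => ?_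
  obtain ⟨l, hl⟩ := h.complete s fun ε hε => by
    obtain ⟨N, hN⟩ := Metric.cauchySeq_iff.1 hs ε (by exact_mod_cast hε)
    refine ⟨N, fun n m hn' hm' => h.lt_of_gaugeNorm_lt ?_⟩
    rw [← hn, ← dist_eq_norm]
    exact hN n hn' m hm'
  refine ⟨l, Metric.tendsto_atTop.2 fun ε hε => ?_⟩
  obtain ⟨q, q1, q2⟩ := exists_rat_btwn hε
  have q1 : 0 < q := by exact_mod_cast q1
  obtain ⟨N, hN⟩ := hl q q1
  refine ⟨N, fun n hn' => ?_⟩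
  rw [dist_eq_norm, hn]
  exact (gaugeNorm_le q1 (hN n hn')).trans_lt q2

end IsRatGauge

/-- Otherwise a rational `r` would lie strictly between `√‖b‖` and `‖a‖`, and testing the hypothesis
at `r` gives a contradiction. This turns `C*`-identities known only at squares of rationals into
inequalities between real norms. -/
theorem gaugeNorm_sq_le_gaugeNorm [AddCommGroup F] [Module ℂ F] (h : IsRatGauge lt') {a : E} {b : F}
    (hab : ∀ r : ℚ, 0 < r → lt' b (r ^ 2) → lt a r) : gaugeNorm lt a ^ 2 ≤ gaugeNorm lt' b := by
  by_contra! hlt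
  have hb := gaugeNorm_nonneg (lt := lt') b
  have h1 : √(gaugeNorm lt' b) < gaugeNorm lt a := (Real.sqrt_lt' (by
    exact lt_of_le_of_ne (gaugeNorm_nonneg a) fun h0 => by
      rw [← h0] at hlt; simp at hlt; linarith)).2 hlt
  obtain ⟨r, r1, r2⟩ := exists_rat_btwn h1
  have r0 : 0 < r := by exact_mod_cast (Real.sqrt_nonneg _).trans_lt r1
  have h2 : gaugeNorm lt' b < ((r ^ 2 : ℚ) : ℝ) := by
    push_cast
    exact (Real.sqrt_lt' (by exact_mod_cast r0)).1 r1
  exact absurd (gaugeNorm_le r0 (hab r r0 (h.lt_of_gaugeNorm_lt h2))) (not_le.2 r2)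

end Gauge

/-! ### Positive elements of `C*`-algebras -/

section CStarAlgebra

variable {A : Type*} [NonUnitalCStarAlgebra A]

attribute [local instance] CStarAlgebra.spectralOrder CStarAlgebra.spectralOrderedRing

/-- In the spectral order, `0 ≤ b^* b ≤ a^* a + b^* b = 0`. -/
theorem eq_zero_of_star_mul_self_add_star_mul_self {a b : A}
    (h : star a * a + star b * b = 0) : b = 0 := by
  have h1 := star_mul_self_nonneg a
  have h2 := star_mul_self_nonneg b
  rw [← CStarRing.star_mul_self_eq_zero_iff]
  refine le_antisymm ?_ h2
  rw [← h]
  exact le_add_of_nonneg_left h1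

/-- A self-adjoint element is positive as soon as its compressions `s a s` are never strictly
negative. -/
theorem exists_star_mul_self_of_compressions {a : A} (ha : IsSelfAdjoint a)
    (h : ∀ s c : A, IsSelfAdjoint s → s * a * s = -(star c * c) → c = 0) :
    ∃ k, a = star k * k := by
  -- Compress by `s = a⁻`: then `s a s = -s³`, and `s³ = (b s)^* (b s)` where `b^* b = s`. The
  -- hypothesis kills `b s`, hence `s³`, and two uses of the `C*`-identity give `s² = 0` and `s =
  -- 0`.
  have hs : IsSelfAdjoint a⁻ := CFC.negPart_nonneg a |>.isSelfAdjoint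
  obtain ⟨b, hb⟩ := CStarAlgebra.nonneg_iff_eq_star_mul_self.1 (CFC.negPart_nonneg a)
  have h1 : a⁻ * a * a⁻ = -(a⁻ * a⁻ * a⁻) := by
    nth_rw 2 [← CFC.posPart_sub_negPart a ha]
    rw [mul_sub, CFC.negPart_mul_posPart, zero_sub, neg_mul]
  have h2 : star (b * a⁻) * (b * a⁻) = a⁻ * a⁻ * a⁻ := by
    rw [star_mul, hs.star_eq]
    nth_rw 4 [hb]
    simp only [mul_assoc]
  have h3 := h a⁻ (b * a⁻) hs (by rw [h1, h2])
  rw [h3, mul_zero] at h2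
  have h4 : a⁻ * a⁻ = 0 := by
    rw [← CStarRing.star_mul_self_eq_zero_iff, star_mul, hs.star_eq, ← mul_assoc, ← h2, zero_mul]
  have h5 : a⁻ = 0 := by
    rw [← CStarRing.star_mul_self_eq_zero_iff, hs.star_eq, h4]
  refine CStarAlgebra.nonneg_iff_eq_star_mul_self.1 ?_
  rw [← CFC.posPart_sub_negPart a ha, h5, sub_zero]
  exact CFC.posPart_nonneg a

/-- Abstract Cauchy-Schwarz, to be used with `p = ⟨x, x⟩`, `q = ⟨y, y⟩`, `c = ⟨y, x⟩`, the quadratic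
expression being `⟨x - y d, x - y d⟩`. For `d = t⁻¹ c` with `t ≥ ‖q‖`, the bound `c^* q c ≤ ‖q‖ c^*
c` leaves `t⁻¹ c^* c ≤ p`; take norms and let `t` tend to `‖q‖`. -/
theorem norm_sq_le_of_quadratic_nonneg {p q c : A} (hq : ∃ k, q = star k * k)
    (h : ∀ d : A, ∃ k, p - star d * c - star c * d + star d * q * d = star k * k) :
    ‖c‖ ^ 2 ≤ ‖q‖ * ‖p‖ := by
  have hq0 : 0 ≤ q := CStarAlgebra.nonneg_iff_eq_star_mul_self.2 hq
  refine le_of_forall_pos_le_add fun ε hε => ?_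
  -- `t` exceeds `‖q‖` slightly so as to be invertible even when `q = 0`; dividing by `‖p‖ + 1`
  -- keeps the total error below `ε`.
  obtain ⟨t, ht0, ht1, ht2⟩ : ∃ t : ℝ, 0 < t ∧ ‖q‖ ≤ t ∧ t * ‖p‖ ≤ ‖q‖ * ‖p‖ + ε := by
    refine ⟨‖q‖ + ε / (‖p‖ + 1), by positivity,
      by linarith [show 0 ≤ ε / (‖p‖ + 1) by positivity], ?_⟩
    rw [add_mul]
    gcongr
    rw [div_mul_eq_mul_div, div_le_iff₀ (by positivity)]
    nlinarith [norm_nonneg p]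
  refine le_trans ?_ ht2
  have h1 := CStarAlgebra.nonneg_iff_eq_star_mul_self.2 (h (t⁻¹ • c))
  have h2 : star (t⁻¹ • c) * q * (t⁻¹ • c) ≤ t⁻¹ • (star c * c) := by
    calc star (t⁻¹ • c) * q * (t⁻¹ • c) = (t⁻¹ * t⁻¹) • (star c * q * c) := by
          rw [star_smul, star_trivial, smul_mul_assoc, smul_mul_assoc, mul_smul_comm, smul_smul]
      _ ≤ (t⁻¹ * t⁻¹) • (‖q‖ • (star c * c)) := by
          gcongr
          exact CStarAlgebra.star_left_conjugate_le_norm_smul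
      _ ≤ (t⁻¹ * t⁻¹) • (t • (star c * c)) := by
          gcongr
          exact star_mul_self_nonneg c
      _ = t⁻¹ • (star c * c) := by
          rw [smul_smul, mul_assoc, inv_mul_cancel₀ ht0.ne', mul_one]
  have h3 : t⁻¹ • (star c * c) ≤ p := by
    have h4 : 0 ≤ p - star (t⁻¹ • c) * c - star c * (t⁻¹ • c) + t⁻¹ • (star c * c) :=
      h1.trans (by gcongr)
    rw [star_smul, star_trivial, smul_mul_assoc, mul_smul_comm, sub_add_cancel, sub_nonneg] at h4
    exact h4
  have h5 := CStarAlgebra.norm_le_norm_of_nonneg_of_le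
    (smul_nonneg (inv_nonneg.2 ht0.le) (star_mul_self_nonneg c)) h3
  rw [norm_smul, CStarRing.norm_star_mul_self, Real.norm_of_nonneg (inv_nonneg.2 ht0.le),
    inv_mul_le_iff₀ ht0] at h5
  nlinarith

end CStarAlgebra

end ToposHilbert

namespace ToposHilbert

/-! ### Constant real and complex numbers -/

section Const

variable {C : Type u} [SmallCategory C] {J : GrothendieckTopology C} {U : C}

namespace DReal

theorem const_add (r s : ℝ) : (const J U r).add (const J U s) = const J U (r + s) := by
  ext q V f
  · change Locally J V (fun W g => ∃ a b : ℚ, q < a + b ∧ Locally J W (fun _ _ => (a : ℝ) < r) ∧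
      Locally J W (fun _ _ => (b : ℝ) < s)) ↔ Locally J V (fun _ _ => (q : ℝ) < r + s)
    constructor
    · refine fun h => h.bind (Q := fun _ _ => (q : ℝ) < r + s) fun W g ⟨a, b, h1, h2, h3⟩ => ?_
      refine (h2.and h3).mono fun _ _ ⟨h4, h5⟩ => ?_
      have : (q : ℝ) < a + b := by exact_mod_cast h1
      linarith
    · refine fun h => h.mono fun W g h1 => ?_
      obtain ⟨a, a1, a2⟩ := exists_rat_btwn (show (q : ℝ) - s < r by linarith)
      obtain ⟨b, b1, b2⟩ := exists_rat_btwn (show (q : ℝ) - a < s by linarith)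
      refine ⟨a, b, ?_, .of_forall fun _ _ => a2, .of_forall fun _ _ => b2⟩
      exact_mod_cast (show (q : ℝ) < a + b by linarith)
  · change Locally J V (fun W g => ∃ a b : ℚ, a + b < q ∧ Locally J W (fun _ _ => r < (a : ℝ)) ∧
      Locally J W (fun _ _ => s < (b : ℝ))) ↔ Locally J V (fun _ _ => r + s < (q : ℝ))
    constructor
    · refine fun h => h.bind (Q := fun _ _ => r + s < (q : ℝ)) fun W g ⟨a, b, h1, h2, h3⟩ => ?_
      refine (h2.and h3).mono fun _ _ ⟨h4, h5⟩ => ?_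
      have : (a : ℝ) + b < q := by exact_mod_cast h1
      linarith
    · refine fun h => h.mono fun W g h1 => ?_
      obtain ⟨a, a1, a2⟩ := exists_rat_btwn (show r < (q : ℝ) - s by linarith)
      obtain ⟨b, b1, b2⟩ := exists_rat_btwn (show s < (q : ℝ) - a by linarith)
      refine ⟨a, b, ?_, .of_forall fun _ _ => a1, .of_forall fun _ _ => b1⟩
      exact_mod_cast (show (a : ℝ) + b < q by linarith)

theorem const_neg (r : ℝ) : (const J U r).neg = const J U (-r) := by
  ext q V f
  · change Locally J V (fun _ _ => r < ((-q : ℚ) : ℝ)) ↔ Locally J V (fun _ _ => (q : ℝ) < -r)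
    push_cast
    simp only [lt_neg]
  · change Locally J V (fun _ _ => ((-q : ℚ) : ℝ) < r) ↔ Locally J V (fun _ _ => -r < (q : ℝ))
    push_cast
    simp only [neg_lt]

theorem real_lt_mul_of_corners {q a b c d s t : ℝ} (h1 : a ≤ s) (h2 : s ≤ b) (h3 : c ≤ t)
    (h4 : t ≤ d) (hac : q < a * c) (had : q < a * d) (hbc : q < b * c) (hbd : q < b * d) :
    q < s * t := by
  have hs : ∀ u : ℝ, q < a * u → q < b * u → q < s * u := by
    intro u ha hb
    rcases le_total 0 u with hu | hu
    · exact lt_of_lt_of_le ha (mul_le_mul_of_nonneg_right h1 hu)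
    · exact lt_of_lt_of_le hb (mul_le_mul_of_nonpos_right h2 hu)
  rcases le_total 0 s with hs' | hs'
  · exact lt_of_lt_of_le (hs c hac hbc) (mul_le_mul_of_nonneg_left h3 hs')
  · exact lt_of_lt_of_le (hs d had hbd) (mul_le_mul_of_nonpos_left h4 hs')

theorem MulBox.const_lt {r s : ℝ} {q : ℚ} {V : C} {f : V ⟶ U}
    (h : MulBox (const J U r) (const J U s) f (fun t => q < t)) :
    Locally J V (fun _ _ => (q : ℝ) < r * s) := by
  obtain ⟨a, b, c, d, h1, h2, h3, h4, h5, h6, h7, h8⟩ := h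
  refine ((Locally.and h1 h2).and (Locally.and h3 h4)).mono fun W g ⟨⟨k1, k2⟩, ⟨k3, k4⟩⟩ => ?_
  exact real_lt_mul_of_corners k1.le k2.le k3.le k4.le (by exact_mod_cast h5)
    (by exact_mod_cast h6) (by exact_mod_cast h7) (by exact_mod_cast h8)

theorem MulBox.const_gt {r s : ℝ} {q : ℚ} {V : C} {f : V ⟶ U}
    (h : MulBox (const J U r) (const J U s) f (fun t => t < q)) :
    Locally J V (fun _ _ => r * s < (q : ℝ)) := by
  obtain ⟨a, b, c, d, h1, h2, h3, h4, h5, h6, h7, h8⟩ := h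
  refine ((Locally.and h1 h2).and (Locally.and h3 h4)).mono fun W g ⟨⟨k1, k2⟩, ⟨k3, k4⟩⟩ => ?_
  have := real_lt_mul_of_corners (q := -q) (neg_le_neg k2.le) (neg_le_neg k1.le) k3.le k4.le
    (by rw [neg_mul, neg_lt_neg_iff]; exact_mod_cast h7)
    (by rw [neg_mul, neg_lt_neg_iff]; exact_mod_cast h8)
    (by rw [neg_mul, neg_lt_neg_iff]; exact_mod_cast h5)
    (by rw [neg_mul, neg_lt_neg_iff]; exact_mod_cast h6)
  linarith

/-- To find a box witnessing `q < r s`, pick a rational `q'` strictly between. A small enough box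
lies above `q` or below `q'`. The second case would give `r s < q'` on a cover; every member of that
cover is then contradictory, so the goal holds there vacuously (the empty sieve may be covering). -/
theorem const_mul (r s : ℝ) : (const J U r).mul (const J U s) = const J U (r * s) := by
  ext q V f
  · change Locally J V (fun _ g => MulBox (const J U r) (const J U s) (g ≫ f) (fun t => q < t)) ↔
      Locally J V (fun _ _ => (q : ℝ) < r * s)
    constructor
    · exact fun h => h.bind (Q := fun _ _ => (q : ℝ) < r * s) fun W g hg => hg.const_lt
    · refine fun h => h.bind fun W g h1 => ?_
      obtain ⟨q', h2, h3⟩ := exists_rat_btwn h1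
      refine ((exists_mulBox_small (const J U r) (const J U s)
        (show q < q' by exact_mod_cast h2)).pullback (g ≫ f)).bind fun Z k hk => ?_
      rcases hk with hk | hk
      · exact .of_forall fun Y m => by simpa using hk.restrict m
      · exact hk.const_gt.mono fun _ _ h4 => absurd h4 (not_lt.2 h3.le)
  · change Locally J V (fun _ g => MulBox (const J U r) (const J U s) (g ≫ f) (fun t => t < q)) ↔
      Locally J V (fun _ _ => r * s < (q : ℝ))
    constructor
    · exact fun h => h.bind (Q := fun _ _ => r * s < (q : ℝ)) fun W g hg => hg.const_gt
    · refine fun h => h.bind fun W g h1 => ?_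
      obtain ⟨q', h2, h3⟩ := exists_rat_btwn h1
      refine ((exists_mulBox_small (const J U r) (const J U s)
        (show q' < q by exact_mod_cast h3)).pullback (g ≫ f)).bind fun Z k hk => ?_
      rcases hk with hk | hk
      · exact hk.const_lt.mono fun _ _ h4 => absurd h4 (not_lt.2 h2.le)
      · exact .of_forall fun Y m => by simpa using hk.restrict m

end DReal

namespace DComplex

theorem const_add (z w : ℂ) : (const J U z).add (const J U w) = const J U (z + w) := by
  simp only [const, add, DReal.const_add, Complex.add_re, Complex.add_im]

theorem const_mul (z w : ℂ) : (const J U z).mul (const J U w) = const J U (z * w) := by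
  simp only [const, mul, DReal.const_add, DReal.const_mul, DReal.const_neg, Complex.mul_re,
    Complex.mul_im, sub_eq_add_neg]

theorem const_conj (z : ℂ) : (const J U z).conj = const J U ((starRingEnd ℂ) z) := by
  simp only [const, conj, DReal.const_neg, Complex.conj_re, Complex.conj_im]

theorem absLT_const {z : ℂ} {r : ℚ} (h : ‖z‖ < r) : (const J U z).AbsLT r := by
  have hr : (0 : ℝ) < r := (norm_nonneg z).trans_lt h
  have h1 : z.re ^ 2 + z.im ^ 2 < (r : ℝ) ^ 2 := by
    have := pow_lt_pow_left₀ h (norm_nonneg z) two_ne_zero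
    rw [Complex.sq_norm, Complex.normSq_apply] at this
    linarith
  -- `z` is enclosed in a rational rectangle inscribed in the disc of radius `r`: first a half-width
  -- `α` that leaves room for the imaginary part, then a half-height `β`.
  obtain ⟨α, a1, a2⟩ := exists_rat_btwn (show |z.re| < √((r : ℝ) ^ 2 - z.im ^ 2) from
    Real.lt_sqrt_of_sq_lt (by rw [sq_abs]; linarith))
  have hα := (abs_nonneg _).trans_lt a1
  have a3 := (Real.lt_sqrt hα.le).1 a2
  obtain ⟨β, b1, b2⟩ := exists_rat_btwn (show |z.im| < √((r : ℝ) ^ 2 - α ^ 2) from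
    Real.lt_sqrt_of_sq_lt (by rw [sq_abs]; linarith))
  have b3 := (Real.lt_sqrt ((abs_nonneg _).trans b1.le)).1 b2
  rw [abs_lt] at a1 b1
  refine .of_forall fun V f => ⟨by exact_mod_cast hr, α, β, ?_, .of_forall fun _ _ => ?_,
    .of_forall fun _ _ => a1.2, .of_forall fun _ _ => ?_, .of_forall fun _ _ => b1.2⟩
  · exact_mod_cast (show (α : ℝ) ^ 2 + β ^ 2 ≤ r ^ 2 by linarith)
  · push_cast; exact a1.1
  · push_cast; exact b1.1

end DComplex

end Const

/-! ### Fibres and their gluing -/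

section Fibres

variable {C : Type u} [SmallCategory C] {J : GrothendieckTopology C}
variable {E X : Sheaf J (Type u)} {p : E ⟶ X}

theorem Fib.ext {U : C} {x : Sec X U} {a b : Fib p x} (h : a.1 = b.1) : a = b := Subtype.ext h

theorem Fib.pull_pull {W V U : C} (g : W ⟶ V) (f : V ⟶ U) {x : Sec X U} {y : Sec X V}
    {z : Sec X W} (hf : res f x = y) (hg : res g y = z) (a : Fib p x) :
    (a.pull f hf).pull g hg = a.pull (g ≫ f) (by rw [← hg, ← hf, res_comp]) :=
  Fib.ext (res_comp g f a.1)

/-- Elements of a fibre that agree locally are equal. -/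
theorem Fib.eq_of_locally {U : C} {x : Sec X U} {a b : Fib p x}
    (h : Locally J U (fun _ f => a.pull f rfl = b.pull f rfl)) : a = b := by
  obtain ⟨S, hS, h⟩ := h
  refine Fib.ext ?_
  have hE := (isSheaf_iff_isSheaf_of_type J E.obj).1 E.property S hS
  exact hE.isSeparatedFor.ext fun V f hf => congrArg Subtype.val (h f hf)

/-- Elements of a fibre that are unique and exist locally exist globally. -/
theorem Fib.exists_of_locally {U : C} {x : Sec X U}
    (P : ∀ ⦃V : C⦄ (f : V ⟶ U), Fib p (res f x) → Prop)
    (stable : ∀ ⦃V W : C⦄ (f : V ⟶ U) (g : W ⟶ V) (a : Fib p (res f x)), P f a →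
      P (g ≫ f) (a.pull g (res_comp g f x)))
    (unique : ∀ ⦃V : C⦄ (f : V ⟶ U) (a b : Fib p (res f x)), P f a → P f b → a = b)
    (h : Locally J U (fun _ f => ∃ a, P f a)) :
    ∃ a : Fib p x, Locally J U (fun _ f => P f (a.pull f rfl)) := by
  obtain ⟨S, hS, h⟩ := h
  choose l hl using h
  have hE := (isSheaf_iff_isSheaf_of_type J E.obj).1 E.property S hS
  have hX := (isSheaf_iff_isSheaf_of_type J X.obj).1 X.property S hS
  have compat : (show Presieve.FamilyOfElements E.obj S.arrows from
      fun V f hf => (l f hf).1).Compatible := by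
    intro V₁ V₂ W g₁ g₂ f₁ f₂ h₁ h₂ hg
    have e₁ := stable f₁ g₁ _ (hl f₁ h₁)
    have e₂ := stable f₂ g₂ _ (hl f₂ h₂)
    -- The two composites agree only propositionally, so their fibres are different types;
    -- generalising over both arrows allows substitution.
    have key : ∀ (k k' : W ⟶ U) (hk : k = k') (a : Fib p (res k x)) (b : Fib p (res k' x)),
        P k a → P k' b → a.1 = b.1 := by
      rintro k _ rfl a b ha hb
      rw [unique k a b ha hb]
    exact key _ _ hg _ _ e₁ e₂
  obtain ⟨e, he, -⟩ := hE _ compat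
  have hp : p.hom.app (op U) e = x := by
    refine hX.isSeparatedFor.ext fun V f hf => ?_
    have h1 := NatTrans.naturality_apply p.hom f.op e
    refine h1.symm.trans ?_
    refine Eq.trans (congrArg (p.hom.app (op V)) (he f hf)) ?_
    exact (l f hf).2
  let a : Fib p x := ⟨e, hp⟩
  refine ⟨a, S, hS, fun V f hf => ?_⟩
  have h1 : a.pull f rfl = l f hf := Fib.ext (he f hf)
  beta_reduce
  rw [h1]
  exact hl f hf

end Fibres

end ToposHilbert

namespace ToposHilbert

variable {C : Type u} [SmallCategory C] {J : GrothendieckTopology C}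

/-! ### Bounds on internal complex numbers and norms on module objects -/

namespace DComplex

variable {U : C}

theorem AbsLT.res {z : DComplex J U} {r : ℚ} (h : z.AbsLT r) {V : C} (f : V ⟶ U) :
    (z.res f).AbsLT r :=
  Locally.pullback h f

theorem AbsLT.conj {z : DComplex J U} {r : ℚ} (h : z.AbsLT r) : z.conj.AbsLT r := by
  refine Locally.mono h fun V f ⟨hr, α, β, h1, h2, h3, h4, h5⟩ =>
    ⟨hr, α, β, h1, h2, h3, ?_, ?_⟩
  · simpa [DComplex.conj, DReal.neg] using h5
  · simpa [DComplex.conj, DReal.neg] using h4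

theorem exists_absLT (z : DComplex J U) :
    Locally J U (fun _ f => ∃ r, 0 < r ∧ (z.res f).AbsLT r) := by
  refine ((z.re.lo_inhabited.and z.re.up_inhabited).and
    (z.im.lo_inhabited.and z.im.up_inhabited)).mono
    fun V f ⟨⟨⟨a, ha⟩, ⟨b, hb⟩⟩, ⟨⟨c, hc⟩, ⟨d, hd⟩⟩⟩ => ?_
  obtain ⟨M, hM⟩ : ∃ M : ℚ, M = |a| + |b| + |c| + |d| + 1 := ⟨_, rfl⟩
  have ha₀ := abs_nonneg a
  have hb₀ := abs_nonneg b
  have hc₀ := abs_nonneg c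
  have hd₀ := abs_nonneg d
  -- The square of half-side `M` lies in the disc of radius `2 M`, as `M² + M² ≤ (2 M)²`.
  refine ⟨2 * M, by linarith, .of_forall fun W g =>
    ⟨by linarith, M, M, by nlinarith, ?_, ?_, ?_, ?_⟩⟩
  · exact z.re.lo_mono (by linarith [neg_abs_le a]) ((z.re.lo a).downward_closed ha g)
  · exact z.re.up_mono (by linarith [le_abs_self b]) ((z.re.up b).downward_closed hb g)
  · exact z.im.lo_mono (by linarith [neg_abs_le c]) ((z.im.lo c).downward_closed hc g)
  · exact z.im.up_mono (by linarith [le_abs_self d]) ((z.im.up d).downward_closed hd g)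

end DComplex

namespace ModuleOver

variable {X : Sheaf J (Type u)} (M : ModuleOver X)

/-- Restriction as a homomorphism of groups. -/
def pullHom {V U : C} (f : V ⟶ U) {x : Sec X U} {y : Sec X V} (h : res f x = y) :
    M.El x →+ M.El y :=
  AddMonoidHom.mk' (fun a => a.pull f h) fun a b => by subst h; exact M.pull_add f a b

variable {M}

theorem El.pull_zero {V U : C} (f : V ⟶ U) {x : Sec X U} {y : Sec X V} (h : res f x = y) :
    (0 : M.El x).pull f h = 0 := map_zero (M.pullHom f h)

theorem El.pull_add {V U : C} (f : V ⟶ U) {x : Sec X U} {y : Sec X V} (h : res f x = y)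
    (a b : M.El x) : (a + b).pull f h = a.pull f h + b.pull f h := map_add (M.pullHom f h) a b

theorem El.pull_sub {V U : C} (f : V ⟶ U) {x : Sec X U} {y : Sec X V} (h : res f x = y)
    (a b : M.El x) : (a - b).pull f h = a.pull f h - b.pull f h := map_sub (M.pullHom f h) a b

theorem El.pull_neg {V U : C} (f : V ⟶ U) {x : Sec X U} {y : Sec X V} (h : res f x = y)
    (a : M.El x) : (-a).pull f h = -a.pull f h := map_neg (M.pullHom f h) a

theorem El.pull_smul {V U : C} (f : V ⟶ U) {x : Sec X U} {y : Sec X V} (h : res f x = y)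
    (z : DComplex J U) (a : M.El x) : (M.smul z a).pull f h = M.smul (z.res f) (a.pull f h) := by
  subst h; exact M.pull_smul f z a

/-- The constant complex numbers act on the sections of a `ℂ`-module object. -/
noncomputable instance module {U : C} (x : Sec X U) : Module ℂ (Fib M.proj x) where
  smul z a := M.smul (DComplex.const J U z) a
  one_smul a := M.one_smul a
  mul_smul z w a := by
    change M.smul (DComplex.const J U (z * w)) a = _
    rw [← DComplex.const_mul]
    exact M.mul_smul _ _ a
  smul_zero z := by
    have := M.smul_add (x := x) (DComplex.const J U z) 0 0
    rw [add_zero] at this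
    exact left_eq_add.1 this
  smul_add z a b := M.smul_add _ a b
  add_smul z w a := by
    change M.smul (DComplex.const J U (z + w)) a = _
    rw [← DComplex.const_add]
    exact M.add_smul _ _ a
  zero_smul a := by
    have := M.add_smul (DComplex.const J U 0) (DComplex.const J U 0) a
    rw [DComplex.const_add, add_zero] at this
    exact left_eq_add.1 this

theorem const_smul_eq {U : C} {x : Sec X U} (z : ℂ) (a : M.El x) :
    M.smul (DComplex.const J U z) a = z • a := rfl

theorem El.pull_const_smul {V U : C} (f : V ⟶ U) {x : Sec X U} {y : Sec X V} (h : res f x = y)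
    (z : ℂ) (a : M.El x) : (z • a).pull f h = z • a.pull f h :=
  El.pull_smul f h _ a

theorem smul_zero_right {U : C} {x : Sec X U} (z : DComplex J U) :
    M.smul z (0 : M.El x) = 0 := by
  have := M.smul_add (x := x) z 0 0
  rw [add_zero] at this
  exact left_eq_add.1 this

theorem smul_sub_right {U : C} {x : Sec X U} (z : DComplex J U) (a b : M.El x) :
    M.smul z (a - b) = M.smul z a - M.smul z b := by
  rw [eq_sub_iff_add_eq, ← M.smul_add, sub_add_cancel]

/-- The norm axioms for a relation `‖a‖ < q`, without separation and completeness. -/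
structure IsNorm (nlt : M.NormRel) : Prop where
  pull : ∀ ⦃V U : C⦄ (f : V ⟶ U) ⦃x : Sec X U⦄ (a : M.El x) (q : ℚ),
    nlt a q → nlt (a.pull f rfl) q
  glue : ∀ ⦃U : C⦄ ⦃x : Sec X U⦄ (a : M.El x) (q : ℚ),
    Locally J U (fun _ f => nlt (a.pull f rfl) q) → nlt a q
  pos : ∀ ⦃U : C⦄ ⦃x : Sec X U⦄ ⦃a : M.El x⦄ ⦃q : ℚ⦄, nlt a q → Locally J U (fun _ _ => 0 < q)
  mono : ∀ ⦃U : C⦄ ⦃x : Sec X U⦄ ⦃a : M.El x⦄ ⦃q r : ℚ⦄, q ≤ r → nlt a q → nlt a r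
  bounded : ∀ ⦃U : C⦄ ⦃x : Sec X U⦄ (a : M.El x),
    Locally J U (fun _ f => ∃ q : ℚ, nlt (a.pull f rfl) q)
  add : ∀ ⦃U : C⦄ ⦃x : Sec X U⦄ ⦃a b : M.El x⦄ ⦃q r : ℚ⦄, nlt a q → nlt b r → nlt (a + b) (q + r)
  smul : ∀ ⦃U : C⦄ ⦃x : Sec X U⦄ ⦃z : DComplex J U⦄ ⦃a : M.El x⦄ ⦃q r : ℚ⦄, z.AbsLT r → nlt a q →
    nlt (M.smul z a) (r * q)

namespace IsNorm

variable {nlt : M.NormRel} {U : C} {x : Sec X U}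

theorem pull' (h : IsNorm nlt) {V : C} (f : V ⟶ U) {y : Sec X V} (hy : res f x = y) {a : M.El x}
    {q : ℚ} (ha : nlt a q) : nlt (a.pull f hy) q := by
  subst hy; exact h.pull f a q ha

theorem const_smul (h : IsNorm nlt) {z : ℂ} {a : M.El x} {q r : ℚ} (hz : ‖z‖ < r) (ha : nlt a q) :
    nlt (z • a) (r * q) :=
  h.smul (DComplex.absLT_const hz) ha

theorem bounded' (h : IsNorm nlt) (a : M.El x) :
    Locally J U (fun _ f => ∃ q : ℚ, 0 < q ∧ nlt (a.pull f rfl) q) :=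
  (h.bounded a).mono fun _ _ ⟨q, hq⟩ =>
    ⟨max q 1, lt_max_of_lt_right one_pos, h.mono (le_max_left q 1) hq⟩

/-- Zero has some bound `r` locally, and `0 = 0 • 0` with `|0| < q / r` improves it to `q`. -/
theorem zero (h : IsNorm nlt) {q : ℚ} (hq : 0 < q) : nlt (0 : M.El x) q := by
  refine h.glue _ _ ((h.bounded' (0 : M.El x)).mono fun V f ⟨r, hr, h1⟩ => ?_)
  have := h.const_smul (z := 0) (r := q / r) (by
    rw [norm_zero]; exact_mod_cast div_pos hq hr) h1
  rwa [zero_smul, ← El.pull_zero (M := M) f rfl, div_mul_cancel₀ _ hr.ne'] at this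

/-- Bounds on scalars are strict, so multiplying by `-1` needs a factor `r / q > 1`. `IsNorm` does
not include roundedness, so this slack reappears in later estimates. -/
theorem neg (h : IsNorm nlt) {a : M.El x} {q : ℚ} (ha : nlt a q) (r : ℚ) (hr : q < r) :
    nlt (-a) r := by
  refine h.glue _ _ ((h.pos ha).mono fun V f hq => ?_)
  have := h.const_smul (z := -1) (r := r / q) (by
    rw [norm_neg, norm_one]; exact_mod_cast (one_lt_div hq).2 hr) (h.pull f a q ha)
  rwa [neg_one_smul, ← El.pull_neg, div_mul_cancel₀ _ hq.ne'] at this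

theorem sub_comm (h : IsNorm nlt) {a b : M.El x} {q : ℚ} (ha : nlt (a - b) q) (r : ℚ)
    (hr : q < r) : nlt (b - a) r := by
  rw [← neg_sub]; exact h.neg ha r hr

end IsNorm

/-! ### Limits of sequences of sections -/

/-- External convergence of a sequence of sections. -/
def Lim (nlt : M.NormRel) {U : C} {x : Sec X U} (s : ℕ → M.El x) (l : M.El x) : Prop :=
  ∀ ε : ℚ, 0 < ε → ∃ N, ∀ n, N ≤ n → nlt (s n - l) ε

/-- The external Cauchy condition for a sequence of sections. -/
def CauchySec (nlt : M.NormRel) {U : C} {x : Sec X U} (s : ℕ → M.El x) : Prop :=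
  ∀ ε : ℚ, 0 < ε → ∃ N, ∀ n m, N ≤ n → N ≤ m → nlt (s n - s m) ε

/-- Local convergence of a sequence of sections. -/
def LocLim (nlt : M.NormRel) {U : C} {x : Sec X U} (s : ℕ → M.El x) (l : M.El x) : Prop :=
  Locally J U (fun _ f => Lim nlt (fun n => (s n).pull f rfl) (l.pull f rfl))

/-- Transports an estimate between fibres over points that are equal only propositionally, such as
those arising from iterated restriction. -/
theorem nlt_sub_congr {nlt : M.NormRel} {U : C} {x y : Sec X U} (h : x = y) {a b : M.El x}
    {a' b' : M.El y} (ha : a.1 = a'.1) (hb : b.1 = b'.1) {q : ℚ} (hab : nlt (a - b) q) :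
    nlt (a' - b') q := by
  subst h
  rwa [← Fib.ext ha, ← Fib.ext hb]

section Limits

variable {nlt : M.NormRel} {U : C} {x : Sec X U} {s : ℕ → M.El x} {l : M.El x}

theorem Lim.congr {y : Sec X U} (h : x = y) {s' : ℕ → M.El y} {l' : M.El y}
    (hs : ∀ n, (s n).1 = (s' n).1) (hl : l.1 = l'.1) (H : Lim nlt s l) : Lim nlt s' l' :=
  fun ε hε => (H ε hε).imp fun _ hN n hn => nlt_sub_congr h (hs n) hl (hN n hn)

theorem Lim.pull (h : IsNorm nlt) (H : Lim nlt s l) {V : C} (f : V ⟶ U) {y : Sec X V}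
    (hy : res f x = y) : Lim nlt (fun n => (s n).pull f hy) (l.pull f hy) :=
  fun ε hε => (H ε hε).imp fun _ hN n hn => by
    rw [← El.pull_sub]; exact h.pull' f hy (hN n hn)

theorem Lim.add (h : IsNorm nlt) {t : ℕ → M.El x} {m : M.El x} (H : Lim nlt s l)
    (H' : Lim nlt t m) : Lim nlt (fun n => s n + t n) (l + m) := fun ε hε => by
  obtain ⟨N, hN⟩ := H (ε / 2) (half_pos hε)
  obtain ⟨N', hN'⟩ := H' (ε / 2) (half_pos hε)
  refine ⟨max N N', fun n hn => ?_⟩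
  have := h.add (hN n ((le_max_left _ _).trans hn)) (hN' n ((le_max_right _ _).trans hn))
  rwa [add_halves, ← add_sub_add_comm] at this

theorem Lim.smul (h : IsNorm nlt) {z : DComplex J U} {r : ℚ} (hr : 0 < r) (hz : z.AbsLT r)
    (H : Lim nlt s l) : Lim nlt (fun n => M.smul z (s n)) (M.smul z l) := fun ε hε => by
  obtain ⟨N, hN⟩ := H (ε / r) (div_pos hε hr)
  refine ⟨N, fun n hn => ?_⟩
  have := h.smul hz (hN n hn)
  rwa [mul_div_cancel₀ _ hr.ne', smul_sub_right] at this

theorem Lim.nlt_sub (h : IsNorm nlt) (H : Lim nlt s l) {a : M.El x} {δ ε : ℚ} (hδ : δ < ε) {N : ℕ}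
    (ha : ∀ n, N ≤ n → nlt (a - s n) δ) : nlt (a - l) ε := by
  obtain ⟨N', hN'⟩ := H (ε - δ) (sub_pos.2 hδ)
  have := h.add (ha (max N N') (le_max_left _ _)) (hN' (max N N') (le_max_right _ _))
  rwa [sub_add_sub_cancel, add_sub_cancel] at this

theorem Lim.unique (h : IsNorm nlt) (sep : M.IsSeparated nlt) {l' : M.El x} (H : Lim nlt s l)
    (H' : Lim nlt s l') : l = l' := by
  rw [← sub_eq_zero]
  refine sep _ _ fun q hq => ?_
  obtain ⟨N, hN⟩ := H (q / 2) (half_pos hq)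
  refine H'.nlt_sub h (δ := 3 / 4 * q) (by linarith) (N := N) fun n hn => ?_
  exact h.sub_comm (hN n hn) _ (by linarith)

/-- The rate of convergence may vary over the members of the cover, but the resulting bound `ε` does
not depend on it and therefore glues. A Cauchy rate given at `U` thus becomes a rate of convergence
at `U`. -/
theorem LocLim.nlt_sub (h : IsNorm nlt) (H : LocLim nlt s l) {a : M.El x} {δ ε : ℚ} (hδ : δ < ε)
    {N : ℕ} (ha : ∀ n, N ≤ n → nlt (a - s n) δ) : nlt (a - l) ε := by
  refine h.glue _ _ (H.mono fun V f hf => ?_)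
  rw [El.pull_sub]
  refine hf.nlt_sub h hδ (N := N) fun n hn => ?_
  rw [← El.pull_sub]
  exact h.pull f _ _ (ha n hn)

theorem LocLim.unique (h : IsNorm nlt) (sep : M.IsSeparated nlt) {l' : M.El x}
    (H : LocLim nlt s l) (H' : LocLim nlt s l') : l = l' :=
  Fib.eq_of_locally ((Locally.and H H').mono fun _ _ ⟨h1, h2⟩ => h1.unique h sep h2)

theorem LocLim.pull (H : LocLim nlt s l) {V : C} (f : V ⟶ U) :
    LocLim nlt (fun n => (s n).pull f rfl) (l.pull f rfl) :=
  (Locally.pullback H f).mono fun _ g hg =>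
    hg.congr (res_comp g f x).symm (fun _ => (res_comp g f _).symm) (res_comp g f _).symm

theorem LocLim.add (h : IsNorm nlt) {t : ℕ → M.El x} {m : M.El x} (H : LocLim nlt s l)
    (H' : LocLim nlt t m) : LocLim nlt (fun n => s n + t n) (l + m) :=
  (Locally.and H H').mono fun _ _ ⟨h1, h2⟩ => by
    simpa only [El.pull_add] using h1.add h h2

theorem LocLim.smul (h : IsNorm nlt) (z : DComplex J U) (H : LocLim nlt s l) :
    LocLim nlt (fun n => M.smul z (s n)) (M.smul z l) :=
  (Locally.and H z.exists_absLT).mono fun _ _ ⟨h1, r, hr, h2⟩ => by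
    simpa only [El.pull_smul] using h1.smul h hr h2

/-- Bridge from sequences to Cauchy approximations: `A n` consists of the sections that are locally
terms of index beyond the Cauchy moduli `N j`, `j ≤ n`. Late terms belong to `A n`, so they are
close to its limit. -/
theorem CauchySec.exists_lim_locally (h : IsNorm nlt) (compl : M.IsComplete nlt)
    (hs : CauchySec nlt s) :
    Locally J U (fun _ f => ∃ l, Lim nlt (fun n => (s n).pull f rfl) l) := by
  choose N hN using fun n : ℕ => hs (1 / ((n : ℚ) + 1)) (by positivity)
  let A : CauchyApprox nlt x :=
    -- Asking for `N j ≤ m` for every `j ≤ n` makes the sets decrease without assuming `N` monotone;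
    -- comparing underlying sections avoids transport between fibres.
    { mem := fun n V f a => Locally J V (fun W g =>
        ∃ m, (∀ j ≤ n, N j ≤ m) ∧ res g a.1 = res (g ≫ f) (s m).1)
      stable := fun n V W f g a ha => (Locally.pullback ha g).mono fun Z k ⟨m, h1, h2⟩ =>
        ⟨m, h1, by
          change res k (res g a.1) = _
          rw [res_comp, h2, Category.assoc]⟩
      glue := fun n V f a ha => Locally.join (ha.mono fun W g hg => Locally.mono hg
        fun Z k ⟨m, h1, h2⟩ => ⟨m, h1, by
          change res k (res g a.1) = _ at h2
          rw [← res_comp, h2, Category.assoc]⟩)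
      inhabited := fun n => .of_forall fun V f =>
        ⟨(s ((Finset.range (n + 1)).sup N)).pull f rfl, .of_forall fun W g =>
          ⟨_, fun j hj => Finset.le_sup (f := N) (Finset.mem_range.2 (Nat.lt_succ_of_le hj)),
            res_comp g f _⟩⟩
      anti := fun n V f a ha => Locally.mono ha fun W g ⟨m, h1, h2⟩ =>
        ⟨m, fun j hj => h1 j (hj.trans n.le_succ), h2⟩
      dist_lt := fun n V f a b ha hb => by
        refine h.glue _ _ ((Locally.and ha hb).mono fun W g ⟨⟨m, h1, h2⟩, ⟨k, h3, h4⟩⟩ => ?_)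
        have e := h.pull' (g ≫ f) (res_comp g f x).symm (hN n m k (h1 n le_rfl) (h3 n le_rfl))
        rw [El.pull_sub] at e ⊢
        exact nlt_sub_congr rfl h2.symm h4.symm e }
  refine (compl x A).mono fun V f ⟨l, hl⟩ => ⟨l, fun ε hε => ?_⟩
  obtain ⟨n, hn⟩ := exists_nat_one_div_lt hε
  refine ⟨(Finset.range (n + 1)).sup N, fun m hm => ?_⟩
  have := hl n (𝟙 V) ((s m).pull (𝟙 V ≫ f) rfl) (.of_forall fun W g => ⟨m, fun j hj =>
    (Finset.le_sup (f := N) (Finset.mem_range.2 (Nat.lt_succ_of_le hj))).trans hm,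
    res_comp g _ _⟩) ε hn
  refine nlt_sub_congr (by rw [Category.id_comp]) ?_ (res_id _) this
  change res (𝟙 V ≫ f) (s m).1 = res f (s m).1
  rw [Category.id_comp]

/-- Limits are unique by separation, so those found on a cover glue. Only a local Cauchy condition
is assumed: for a Cauchy sequence of operators evaluated at `x`, the rate depends on a bound of
`‖x‖`, which exists only locally. -/
theorem exists_locLim (h : IsNorm nlt) (sep : M.IsSeparated nlt) (compl : M.IsComplete nlt)
    (hs : Locally J U (fun _ f => CauchySec nlt (fun n => (s n).pull f rfl))) :
    ∃ l, LocLim nlt s l := by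
  refine Fib.exists_of_locally (fun V f a => Lim nlt (fun n => (s n).pull f rfl) a) ?_ ?_ ?_
  · exact fun V W f g a ha =>
      (ha.pull h g (res_comp g f x)).congr rfl (fun n => res_comp g f _) rfl
  · exact fun V f a b ha hb => ha.unique h sep hb
  · refine hs.bind fun V f hf => (hf.exists_lim_locally h compl).mono fun W g ⟨l, hl⟩ => ?_
    exact ⟨⟨l.1, l.2.trans (res_comp g f x)⟩,
      hl.congr (res_comp g f x) (fun n => res_comp g f _) rfl⟩

theorem CauchySec.exists_locLim (h : IsNorm nlt) (sep : M.IsSeparated nlt)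
    (compl : M.IsComplete nlt) (hs : CauchySec nlt s) : ∃ l, LocLim nlt s l :=
  ModuleOver.exists_locLim h sep compl (.of_forall fun _ f ε hε => (hs ε hε).imp
    fun _ hN n m hn hm => by rw [← El.pull_sub]; exact h.pull f _ _ (hN n m hn hm))

end Limits

end ModuleOver

/-! ### Bounded global sections of a Banach space object -/

section BoundedSections

open ModuleOver

variable {X : Sheaf J (Type u)} (B : BanachOver X)

theorem BanachOver.isNorm : IsNorm B.nlt where
  pull := B.nlt_pull
  glue := B.nlt_glue
  pos := B.nlt_pos
  mono U x a q r hqr ha := by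
    rcases hqr.eq_or_lt with rfl | hqr
    · exact ha
    · exact (B.nlt_rounded a r).2 (.of_forall fun V f => ⟨q, hqr, B.nlt_pull f a q ha⟩)
  bounded := B.nlt_bounded
  add U x a b q r := B.nlt_add a b q r
  smul U x z a q r hz ha := (B.nlt_smul z a _).2 (.of_forall fun V f =>
    ⟨r, q, le_rfl, hz.res f, B.nlt_pull f a q ha⟩)

variable {B}

namespace BoundedSection

@[ext]
theorem ext {s t : BoundedSection B} (h : ∀ (U : C) (x : Sec X U), s.app x = t.app x) : s = t := by
  obtain ⟨a, _, _⟩ := s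
  obtain ⟨b, _, _⟩ := t
  have : @a = @b := by funext U x; exact h U x
  subst this
  rfl

scoped instance : Zero (BoundedSection B) where
  zero :=
    { app := fun _ => 0
      pull_app := fun f _ => El.pull_zero (M := B.toModuleOver) f rfl
      bounded := ⟨1, one_pos, fun _ _ => B.isNorm.zero one_pos⟩ }

scoped instance : Add (BoundedSection B) where
  add s t :=
    { app := fun x => s.app x + t.app x
      pull_app := fun f x => by rw [El.pull_add (M := B.toModuleOver), s.pull_app, t.pull_app]
      bounded := by
        obtain ⟨K, hK, hs⟩ := s.bounded
        obtain ⟨L, hL, ht⟩ := t.bounded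
        exact ⟨K + L, add_pos hK hL, fun U x => B.isNorm.add (hs U x) (ht U x)⟩ }

scoped instance : Neg (BoundedSection B) where
  neg s :=
    { app := fun x => -s.app x
      pull_app := fun f x => by rw [El.pull_neg (M := B.toModuleOver), s.pull_app]
      bounded := by
        obtain ⟨K, hK, hs⟩ := s.bounded
        exact ⟨K + 1, by linarith, fun U x => B.isNorm.neg (hs U x) _ (by linarith)⟩ }

noncomputable scoped instance : SMul ℂ (BoundedSection B) where
  smul z s :=
    { app := fun x => z • s.app x
      pull_app := fun f x => by rw [El.pull_const_smul (M := B.toModuleOver), s.pull_app]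
      bounded := by
        obtain ⟨K, hK, hs⟩ := s.bounded
        obtain ⟨r, hr⟩ := exists_rat_gt ‖z‖
        have hr0 : 0 < r := by exact_mod_cast (norm_nonneg z).trans_lt hr
        exact ⟨r * K, mul_pos hr0 hK, fun U x => B.isNorm.const_smul hr (hs U x)⟩ }

theorem add_app (s t : BoundedSection B) {U : C} (x : Sec X U) :
    (s + t).app x = s.app x + t.app x := rfl

theorem neg_app (s : BoundedSection B) {U : C} (x : Sec X U) : (-s).app x = -s.app x := rfl

scoped instance : AddCommGroup (BoundedSection B) where
  __ := AddGroup.ofLeftAxioms (G := BoundedSection B)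
    (fun s t r => by ext U x; exact add_assoc _ _ _)
    (fun s => by ext U x; exact zero_add _) (fun s => by ext U x; exact neg_add_cancel _)
  add_comm s t := by ext U x; exact add_comm _ _

theorem sub_app (s t : BoundedSection B) {U : C} (x : Sec X U) :
    (s - t).app x = s.app x - t.app x := by
  rw [sub_eq_add_neg, add_app, neg_app, sub_eq_add_neg]

noncomputable scoped instance : Module ℂ (BoundedSection B) where
  one_smul s := by ext U x; exact one_smul ℂ _
  mul_smul z w s := by ext U x; exact mul_smul _ _ _
  smul_zero z := by ext U x; exact smul_zero _
  smul_add z s t := by ext U x; exact smul_add _ _ _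
  add_smul z w s := by ext U x; exact add_smul _ _ _
  zero_smul s := by ext U x; exact zero_smul ℂ _

/-- The relation `‖s‖ < q` for bounded sections, where `q` is an external bound. -/
def LT (s : BoundedSection B) (q : ℚ) : Prop := ∀ (U : C) (x : Sec X U), B.nlt (s.app x) q

/-- For completeness, limits are taken separately at every point of every stage. Uniqueness makes
them compatible with restriction, and the Cauchy rate, common to all stages, makes convergence
uniform and the limit bounded. -/
theorem isRatGauge : IsRatGauge (LT (B := B)) where
  bounded s := s.bounded
  mono s q r _ hqr hs U x := B.isNorm.mono hqr (hs U x)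
  add s t q r _ _ hs ht U x := B.isNorm.add (hs U x) (ht U x)
  smul z r s q hz _ hs U x := B.isNorm.const_smul hz (hs U x)
  separated s hs := by
    ext U x
    exact B.separated x _ fun q hq => hs q hq U x
  complete s hs := by
    choose l hl using fun (U : C) (x : Sec X U) =>
      CauchySec.exists_locLim (s := fun n => (s n).app x) B.isNorm B.separated B.complete
        fun ε hε => (hs ε hε).imp fun N hN n m hn hm => by
          rw [← sub_app]; exact hN n m hn hm U x
    have key : ∀ ε : ℚ, 0 < ε → ∃ N, ∀ n, N ≤ n → ∀ (U : C) (x : Sec X U),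
        B.nlt ((s n).app x - l U x) ε := fun ε hε => by
      obtain ⟨N, hN⟩ := hs (ε / 2) (half_pos hε)
      refine ⟨N, fun n hn U x => (hl U x).nlt_sub B.isNorm (half_lt_self hε) (N := N)
        fun m hm => ?_⟩
      rw [← sub_app]
      exact hN n m hn hm U x
    refine ⟨⟨fun {U} x => l U x, fun {V U} f x => ?_, ?_⟩, fun ε hε => ?_⟩
    · refine LocLim.unique B.isNorm B.separated ((hl U x).pull f) ?_
      simpa only [(s _).pull_app] using hl V (res f x)
    · obtain ⟨N, hN⟩ := key 1 one_pos
      obtain ⟨K, hK, hK'⟩ := (s N).bounded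
      -- `K` bounds `s N`, which is at distance less than `1` from the limit; reversing the
      -- difference weakens `1` to `2`.
      refine ⟨2 + K, by linarith, fun U x => ?_⟩
      have := B.isNorm.add (B.isNorm.sub_comm (hN N le_rfl U x) 2 one_lt_two) (hK' U x)
      rwa [sub_add_cancel] at this
    · refine (key ε hε).imp fun N hN n hn U x => ?_
      rw [sub_app]
      exact hN n hn U x

end BoundedSection

end BoundedSections

end ToposHilbert

namespace ToposHilbert

variable {C : Type u} [SmallCategory C] {J : GrothendieckTopology C}

open ModuleOver

/-! ### The external `C*`-algebra of bounded endomorphisms at a stage -/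

namespace CStarCategoryObject

variable {𝔄 : CStarCategoryObject J} {U : C}

theorem zero_comp {a b c : Sec 𝔄.Ob U} (f : 𝔄.Mor a b) :
    𝔄.comp (0 : 𝔄.Mor b c) f = 0 := by
  have := 𝔄.add_comp (0 : 𝔄.Mor b c) 0 f
  rw [add_zero] at this
  exact left_eq_add.1 this

theorem comp_zero {a b c : Sec 𝔄.Ob U} (g : 𝔄.Mor b c) :
    𝔄.comp g (0 : 𝔄.Mor a b) = 0 := by
  have := 𝔄.comp_add g (0 : 𝔄.Mor a b) 0
  rw [add_zero] at this
  exact left_eq_add.1 this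

theorem sub_comp {a b c : Sec 𝔄.Ob U} (g g' : 𝔄.Mor b c) (f : 𝔄.Mor a b) :
    𝔄.comp (g - g') f = 𝔄.comp g f - 𝔄.comp g' f := by
  rw [eq_sub_iff_add_eq, ← 𝔄.add_comp, sub_add_cancel]

theorem Mor.restrict_comp {V : C} (k : V ⟶ U) {a b c : Sec 𝔄.Ob U} (g : 𝔄.Mor b c)
    (f : 𝔄.Mor a b) : Mor.restrict k (𝔄.comp g f) = 𝔄.comp (Mor.restrict k g) (Mor.restrict k f) :=
  𝔄.comp_pull k g f

theorem Mor.restrict_star {V : C} (k : V ⟶ U) {a b : Sec 𝔄.Ob U} (f : 𝔄.Mor a b) :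
    Mor.restrict k (𝔄.star f) = 𝔄.star (Mor.restrict k f) :=
  𝔄.star_pull k f

end CStarCategoryObject

open ToposHilbert.CStarCategoryObject hiding star

section EndAlg

variable {𝔄 : CStarCategoryObject J} {U : C}

/-- The externally bounded endomorphisms of `a` at the stage `U`. -/
def boundedEnd (a : Sec 𝔄.Ob U) : Submodule ℂ (Fib 𝔄.mor.proj (pair a a)) where
  carrier := {m | ∃ q, 0 < q ∧ 𝔄.mor.nlt m q}
  add_mem' := fun ⟨q, hq, h⟩ ⟨r, hr, h'⟩ => ⟨q + r, add_pos hq hr, 𝔄.mor.isNorm.add h h'⟩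
  zero_mem' := ⟨1, one_pos, 𝔄.mor.isNorm.zero one_pos⟩
  smul_mem' z m := fun ⟨q, hq, h⟩ => by
    obtain ⟨r, hr⟩ := exists_rat_gt ‖z‖
    have hr0 : 0 < r := by exact_mod_cast (norm_nonneg z).trans_lt hr
    exact ⟨r * q, mul_pos hr0 hq, 𝔄.mor.isNorm.const_smul hr h⟩

/-- The `C*`-algebra of externally bounded endomorphisms of `a` at the stage `U`. -/
def EndAlg (a : Sec 𝔄.Ob U) : Type u := boundedEnd a

namespace EndAlg

variable {a : Sec 𝔄.Ob U}

/-- The underlying endomorphism. -/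
def val (m : EndAlg a) : 𝔄.Mor a a := Subtype.val m

/-- An endomorphism with an external bound. -/
def mk (m : 𝔄.Mor a a) (h : ∃ q, 0 < q ∧ 𝔄.mor.nlt m q) : EndAlg a := ⟨m, h⟩

theorem ext {m n : EndAlg a} (h : m.val = n.val) : m = n := Subtype.ext h

noncomputable instance : AddCommGroup (EndAlg a) := inferInstanceAs (AddCommGroup (boundedEnd a))

noncomputable instance : Module ℂ (EndAlg a) := inferInstanceAs (Module ℂ (boundedEnd a))

instance : Mul (EndAlg a) where
  mul m n := mk (𝔄.comp m.val n.val) (by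
    obtain ⟨q, hq, h⟩ := m.2
    obtain ⟨r, hr, h'⟩ := n.2
    exact ⟨q * r, mul_pos hq hr, 𝔄.nlt_comp _ _ q r h h'⟩)

instance : Star (EndAlg a) where
  star m := mk (𝔄.star m.val) (by
    obtain ⟨q, hq, h⟩ := m.2
    exact ⟨q, hq, (𝔄.nlt_star _ q).2 h⟩)

theorem val_add (m n : EndAlg a) : (m + n).val = m.val + n.val := rfl
theorem val_sub (m n : EndAlg a) : (m - n).val = m.val - n.val := rfl
theorem val_zero : (0 : EndAlg a).val = 0 := rfl
theorem val_mul (m n : EndAlg a) : (m * n).val = 𝔄.comp m.val n.val := rfl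
theorem val_star (m : EndAlg a) : (star m).val = 𝔄.star m.val := rfl
theorem val_smul (z : ℂ) (m : EndAlg a) : (z • m).val = z • m.val := rfl

/-- The relation `‖m‖ < q` on the algebra of bounded endomorphisms. -/
def LT (m : EndAlg a) (q : ℚ) : Prop := 𝔄.mor.nlt m.val q

theorem isRatGauge : IsRatGauge (LT (a := a)) where
  bounded m := m.2
  mono m q r _ hqr h := 𝔄.mor.isNorm.mono hqr h
  add m n q r _ _ h h' := 𝔄.mor.isNorm.add h h'
  smul z r m q hz _ h := 𝔄.mor.isNorm.const_smul hz h
  separated m h := ext (𝔄.mor.separated _ _ h)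
  complete s hs := by
    obtain ⟨l, hl⟩ := CauchySec.exists_locLim (s := fun n => (s n).val) 𝔄.mor.isNorm
      𝔄.mor.separated 𝔄.mor.complete hs
    have key : ∀ ε : ℚ, 0 < ε → ∃ N, ∀ n, N ≤ n → 𝔄.mor.nlt ((s n).val - l) ε := fun ε hε => by
      obtain ⟨N, hN⟩ := hs (ε / 2) (half_pos hε)
      exact ⟨N, fun n hn => hl.nlt_sub 𝔄.mor.isNorm (half_lt_self hε) (N := N)
        fun m hm => hN n m hn hm⟩
    refine ⟨mk l ?_, key⟩
    obtain ⟨N, hN⟩ := key 1 one_pos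
    obtain ⟨K, hK, hK'⟩ := (s N).2
    refine ⟨2 + K, by linarith, ?_⟩
    have := 𝔄.mor.isNorm.add (𝔄.mor.isNorm.sub_comm (hN N le_rfl) 2 one_lt_two) hK'
    exact (sub_add_cancel l (s N).val) ▸ this

noncomputable instance : NormedAddCommGroup (EndAlg a) := isRatGauge.normedAddCommGroup

noncomputable instance : NonUnitalNormedRing (EndAlg a) where
  __ := (inferInstance : NormedAddCommGroup (EndAlg a))
  left_distrib m n k := ext (𝔄.comp_add _ _ _)
  right_distrib m n k := ext (𝔄.add_comp _ _ _)
  zero_mul m := ext (zero_comp _)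
  mul_zero m := ext (comp_zero _)
  mul_assoc m n k := ext (𝔄.comp_assoc _ _ _)
  norm_mul_le m n := by
    refine le_mul_of_forall_rat (norm_nonneg m) (norm_nonneg n) fun q r hq hr => ?_
    have hq0 : 0 < q := by exact_mod_cast (norm_nonneg m).trans_lt hq
    have hr0 : 0 < r := by exact_mod_cast (norm_nonneg n).trans_lt hr
    exact_mod_cast gaugeNorm_le (mul_pos hq0 hr0) (𝔄.nlt_comp _ _ q r
      (isRatGauge.lt_of_gaugeNorm_lt hq) (isRatGauge.lt_of_gaugeNorm_lt hr))

instance : StarRing (EndAlg a) where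
  star_involutive _ := ext (𝔄.star_star _)
  star_mul _ _ := ext (𝔄.star_comp _ _)
  star_add _ _ := ext (𝔄.star_add _ _)

noncomputable instance : NormedSpace ℂ (EndAlg a) := isRatGauge.normedSpace

/-- This makes the functional calculus and the spectral order available at each stage. Elements with
a bound at `U` itself are needed, as arbitrary sections are bounded only locally and have no
real-valued norm at `U`. -/
noncomputable instance : NonUnitalCStarAlgebra (EndAlg a) where
  toCompleteSpace := isRatGauge.completeSpace
  norm_mul_self_le _ := by
    rw [← sq]
    exact gaugeNorm_sq_le_gaugeNorm isRatGauge fun r hr h =>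
      (𝔄.nlt_star_comp_self _ r hr).1 h
  smul_assoc _ _ _ := ext (𝔄.smul_comp _ _ _)
  smul_comm _ _ _ := ext (𝔄.comp_smul _ _ _).symm
  star_smul z m := ext <| by
    rw [val_star, val_smul, ← const_smul_eq]
    refine (𝔄.star_smul _ _).trans ?_
    rw [DComplex.const_conj]
    rfl

/-- Restriction of bounded endomorphisms. -/
def restrict {V : C} (f : V ⟶ U) (m : EndAlg a) : EndAlg (res f a) :=
  mk (Mor.restrict f m.val) (by
    obtain ⟨q, hq, h⟩ := m.2
    exact ⟨q, hq, 𝔄.mor.isNorm.pull' f _ h⟩)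

theorem restrict_mul {V : C} (f : V ⟶ U) (m n : EndAlg a) :
    (m * n).restrict f = m.restrict f * n.restrict f := ext (Mor.restrict_comp f _ _)

theorem restrict_star {V : C} (f : V ⟶ U) (m : EndAlg a) :
    (star m).restrict f = star (m.restrict f) := ext (Mor.restrict_star f _)

theorem restrict_neg {V : C} (f : V ⟶ U) (m : EndAlg a) :
    (-m).restrict f = -m.restrict f :=
  ext (El.pull_neg (M := 𝔄.mor.toModuleOver) f (res_pair f a a) _)

end EndAlg

/-- An internally positive endomorphism is locally of the form `k^* k` with `k` externally
bounded. -/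
theorem EndAlg.exists_of_isPositive {a : Sec 𝔄.Ob U} {t : 𝔄.Mor a a} (h : IsPositive t) :
    Locally J U (fun _ f => ∃ k : EndAlg (res f a), Mor.restrict f t = (star k * k).val) := by
  -- Restricting twice or once along the composite gives objects that are only propositionally
  -- equal; this moves `k` from one to the other.
  have congr : ∀ {V : C} {b c : Sec 𝔄.Ob V} (_ : b = c) (k : 𝔄.Mor b b) (q : ℚ),
      𝔄.mor.nlt k q → ∃ k' : 𝔄.Mor c c, 𝔄.mor.nlt k' q ∧
        (𝔄.comp (𝔄.star k) k).1 = (𝔄.comp (𝔄.star k') k').1 := by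
    rintro V b _ rfl k q hq
    exact ⟨k, hq, rfl⟩
  refine h.bind fun V f ⟨k, hk⟩ => ((𝔄.mor.isNorm).bounded' k).mono fun W g ⟨q, hq, hq'⟩ => ?_
  obtain ⟨k', h1, h2⟩ := congr (res_comp g f a) (Mor.restrict g k) q hq'
  refine ⟨EndAlg.mk k' ⟨q, hq, h1⟩, Fib.ext (Eq.trans ?_ h2)⟩
  rw [← Mor.restrict_star, ← Mor.restrict_comp, ← hk]
  exact (res_comp g f t.1).symm

/-- An internally positive bounded endomorphism is positive in the external `C*`-algebra. -/
theorem EndAlg.exists_star_mul_self {a : Sec 𝔄.Ob U} (t : EndAlg a) (h : IsPositive t.val) :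
    ∃ k, t = star k * k := by
  -- The local square roots `k` need not glue, but the criterion only asks for equations, which can
  -- be verified on a cover. Where `t = k^* k`, the relation `s t s = -c^* c` reads `(k s)^* (k s) +
  -- c^* c = 0`.
  refine exists_star_mul_self_of_compressions (EndAlg.ext ?_) fun s c hs hc => EndAlg.ext ?_
  · refine Fib.eq_of_locally (h.mono fun V f ⟨k, hk⟩ => ?_)
    change Mor.restrict f (𝔄.star t.val) = Mor.restrict f t.val
    rw [Mor.restrict_star, hk, 𝔄.star_comp, 𝔄.star_star]
  · refine Fib.eq_of_locally ((EndAlg.exists_of_isPositive h).mono fun V f ⟨k, hk⟩ => ?_)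
    have hk' : t.restrict f = star k * k := EndAlg.ext hk
    have h1 := congrArg (EndAlg.restrict f) hc
    simp only [EndAlg.restrict_mul, EndAlg.restrict_neg, EndAlg.restrict_star, hk'] at h1
    have h2 : star (s.restrict f) = s.restrict f := by
      rw [← EndAlg.restrict_star, hs.star_eq]
    have h3 : star (k * s.restrict f) * (k * s.restrict f) +
        star (c.restrict f) * c.restrict f = 0 := by
      rw [star_mul, h2, ← add_eq_zero_iff_eq_neg.2 h1]
      simp only [mul_assoc]
    have h4 := congrArg EndAlg.val (eq_zero_of_star_mul_self_add_star_mul_self h3)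
    exact h4.trans (El.pull_zero (M := 𝔄.mor.toModuleOver) f (res_pair f a a)).symm

end EndAlg

/-! ### The norm of a Hilbert module -/

namespace PreHilbertModule

variable {𝔄 : CStarCategoryObject J} (H : PreHilbertModule 𝔄) {U : C}

theorem add_inner {a b : Sec 𝔄.Ob U} (y y' : H.El b) (x : H.El a) :
    H.inner (y + y') x = H.inner y x + H.inner y' x := by
  rw [H.inner_symm, H.inner_add, 𝔄.star_add, ← H.inner_symm, ← H.inner_symm]

theorem inner_sub {a b : Sec 𝔄.Ob U} (y : H.El b) (x x' : H.El a) :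
    H.inner y (x - x') = H.inner y x - H.inner y x' := by
  rw [eq_sub_iff_add_eq, ← H.inner_add, sub_add_cancel]

theorem sub_inner {a b : Sec 𝔄.Ob U} (y y' : H.El b) (x : H.El a) :
    H.inner (y - y') x = H.inner y x - H.inner y' x := by
  rw [eq_sub_iff_add_eq, ← H.add_inner, sub_add_cancel]

theorem smul_inner {a b : Sec 𝔄.Ob U} (z : DComplex J U) (y : H.El b) (x : H.El a) :
    H.inner (H.smul z y) x = 𝔄.mor.smul z.conj (H.inner y x) := by
  rw [H.inner_symm, H.inner_smul, 𝔄.star_smul, ← H.inner_symm]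

theorem act_inner {a b c : Sec 𝔄.Ob U} (y : H.El b) (f : 𝔄.Mor c b) (x : H.El a) :
    H.inner (H.act y f) x = 𝔄.comp (𝔄.star f) (H.inner y x) := by
  rw [H.inner_symm, H.inner_act, 𝔄.star_comp, ← H.inner_symm]

theorem inner_pull_self {V : C} (k : V ⟶ U) {a : Sec 𝔄.Ob U} (y x : H.El a) :
    Fib.pull k rfl (H.inner y x) = H.inner (y.pull k rfl) (x.pull k rfl) :=
  H.inner_pull k y x

/-- The quadratic expression of `norm_sq_le_of_quadratic_nonneg` is `⟨x - y d, x - y d⟩`, which is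
internally positive, hence positive in `EndAlg a`. -/
theorem norm_inner_sq_le {a : Sec 𝔄.Ob U} {x y : H.El a} {p q c : EndAlg a}
    (hp : p.val = H.inner x x) (hq : q.val = H.inner y y) (hc : c.val = H.inner y x) :
    ‖c‖ ^ 2 ≤ ‖q‖ * ‖p‖ := by
  refine norm_sq_le_of_quadratic_nonneg
    (q.exists_star_mul_self (by rw [hq]; exact H.inner_self_pos y)) fun d =>
    EndAlg.exists_star_mul_self _ ?_
  have : (p - star d * c - star c * d + star d * q * d).val =
      H.inner (x - H.act y d.val) (x - H.act y d.val) := by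
    rw [H.inner_sub, H.sub_inner, H.sub_inner, H.inner_act, H.inner_act, H.act_inner, H.act_inner,
      EndAlg.val_add, EndAlg.val_sub, EndAlg.val_sub, EndAlg.val_mul, EndAlg.val_mul,
      EndAlg.val_mul, EndAlg.val_mul, EndAlg.val_star, EndAlg.val_star, hp, hq, hc,
      ← H.inner_symm]
    abel
  rw [this]
  exact H.inner_self_pos _

/-- The Cauchy-Schwarz inequality. -/
theorem nlt_inner {a : Sec 𝔄.Ob U} {x y : H.El a} {q r : ℚ} (hy : H.nlt y q) (hx : H.nlt x r) :
    𝔄.mor.nlt (H.inner y x) (q * r) := by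
  have N := 𝔄.mor.isNorm
  refine N.glue _ _ ?_
  -- Roundedness gives `‖⟨x, x⟩‖ < p'` with `p' < r²`; this gap makes the final inequality strict.
  -- The bound `s` on `⟨y, x⟩` only serves to place it in `EndAlg`.
  have h1 := (𝔄.mor.nlt_rounded _ _).1 hx.2
  refine (h1.and ((N.bounded' (H.inner y x)).and (Locally.and hx.1 hy.1))).bind
    fun V f ⟨⟨p', hp', hp⟩, ⟨s, hs, hc⟩, hr0, hq0⟩ => ?_
  refine (N.pos hp).mono fun W g hp0 => ?_
  have e : ∀ m : 𝔄.Mor a a, m.pull (g ≫ f) rfl =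
      Fib.pull g (res_comp g f (pair a a)) (m.pull f rfl) := fun m =>
    (Fib.pull_pull (p := 𝔄.mor.proj) g f rfl _ m).symm
  have hp2 := N.pull' g (res_comp g f (pair a a)) hp
  have hc2 := N.pull' g (res_comp g f (pair a a)) hc
  have hq2 := N.pull' (g ≫ f) rfl hy.2
  rw [← e, inner_pull_self] at hp2 hc2
  rw [inner_pull_self] at hq2 ⊢
  have key := H.norm_inner_sq_le (p := EndAlg.mk _ ⟨p', hp0, hp2⟩)
    (q := EndAlg.mk _ ⟨q ^ 2, by positivity, hq2⟩) (c := EndAlg.mk _ ⟨s, hs, hc2⟩) rfl rfl rfl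
  have k1 : ‖EndAlg.mk _ ⟨p', hp0, hp2⟩‖ ≤ p' := gaugeNorm_le hp0 hp2
  have k2 : ‖EndAlg.mk _ ⟨q ^ 2, by positivity, hq2⟩‖ ≤ ((q ^ 2 : ℚ) : ℝ) :=
    gaugeNorm_le (by positivity) hq2
  refine EndAlg.isRatGauge.lt_of_gaugeNorm_lt (a := EndAlg.mk _ ⟨s, hs, hc2⟩) (q := q * r) ?_
  refine lt_of_pow_lt_pow_left₀ 2 (by exact_mod_cast (mul_pos hq0 hr0).le) ?_
  have k3 : q ^ 2 * p' < (q * r) ^ 2 := by rw [mul_pow]; gcongr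
  refine key.trans_lt ((mul_le_mul k2 k1 (norm_nonneg _) ?_).trans_lt ?_)
  · exact_mod_cast sq_nonneg q
  · exact_mod_cast k3

theorem isNorm : ModuleOver.IsNorm H.nlt where
  pull V U f x a q h := ⟨Locally.pullback h.1 f, by
    rw [← inner_pull_self]; exact 𝔄.mor.isNorm.pull' f rfl h.2⟩
  glue U x a q h := ⟨Locally.join (h.mono fun _ _ h => h.1), 𝔄.mor.isNorm.glue _ _
    (h.mono fun _ _ h => by rw [inner_pull_self]; exact h.2)⟩
  pos U x a q h := h.1
  mono U x a q r hqr h := ⟨h.1.mono fun _ _ hq => hq.trans_le hqr, 𝔄.mor.isNorm.glue _ _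
    (h.1.mono fun V f hq => 𝔄.mor.isNorm.mono (by gcongr) (𝔄.mor.isNorm.pull' f rfl h.2))⟩
  bounded U x a := (𝔄.mor.isNorm.bounded (H.inner a a)).mono fun V f ⟨q, hq⟩ =>
    ⟨max q 1, .of_forall fun _ _ => lt_max_of_lt_right one_pos, by
      rw [inner_pull_self] at hq
      refine 𝔄.mor.isNorm.mono ?_ hq
      nlinarith [le_max_left q 1, le_max_right q 1]⟩
  add U x a b q r h h' := ⟨(Locally.and h.1 h'.1).mono fun _ _ h => add_pos h.1 h.2, by
    rw [H.inner_add, H.add_inner, H.add_inner]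
    have := 𝔄.mor.isNorm.add (𝔄.mor.isNorm.add h.2 (H.nlt_inner h' h))
      (𝔄.mor.isNorm.add (H.nlt_inner h h') h'.2)
    exact 𝔄.mor.isNorm.mono (by linarith) this⟩
  smul U x z a q r hz h := ⟨(Locally.and hz h.1).mono fun _ _ h => mul_pos h.1.1 h.2, by
    rw [H.inner_smul, H.smul_inner]
    exact 𝔄.mor.isNorm.mono (by linarith) (𝔄.mor.isNorm.smul hz (𝔄.mor.isNorm.smul hz.conj h.2))⟩

theorem nlt_act {a b : Sec 𝔄.Ob U} {x : H.El a} {f : 𝔄.Mor b a} {q r : ℚ} (hx : H.nlt x q)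
    (hr : 0 < r) (hf : 𝔄.mor.nlt f r) : H.nlt (H.act x f) (q * r) := by
  refine ⟨hx.1.mono fun _ _ hq => mul_pos hq hr, ?_⟩
  rw [H.inner_act, H.act_inner]
  refine 𝔄.mor.isNorm.mono (by linarith) (𝔄.nlt_comp _ _ _ _
    (𝔄.nlt_comp _ _ _ _ ((𝔄.nlt_star f r).2 hf) hx.2) hf)

/-- If `‖x‖ ^ 2 ≤ L ‖x‖` then `‖x‖ ≤ L`. -/
theorem nlt_of_sq_le {a : Sec 𝔄.Ob U} {x : H.El a} {L : ℚ} (hL : 0 < L)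
    (h : ∀ ⦃V : C⦄ (f : V ⟶ U) (s : ℚ), 0 < s → H.nlt (x.pull f rfl) s →
      𝔄.mor.nlt (H.inner (x.pull f rfl) (x.pull f rfl)) (L * s)) {q : ℚ} (hq : L < q) :
    H.nlt x q := by
  refine H.isNorm.glue _ _ ((H.isNorm.bounded' x).mono fun V f ⟨s, hs, hs'⟩ => ?_)
  -- One cannot divide by an upper cut, so the bound is improved iteratively: `‖x‖ < L + δ` gives
  -- `‖x‖² < L (L + δ) ≤ (L + δ / 2)²`.
  have step : ∀ n : ℕ, H.nlt (x.pull f rfl) (L + s / 2 ^ n) := by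
    intro n
    induction n with
    | zero => exact H.isNorm.mono (by simp [hL.le]) hs'
    | succ n ih =>
      have h0 : 0 < s / 2 ^ n := by positivity
      refine ⟨.of_forall fun _ _ => by positivity, 𝔄.mor.isNorm.mono ?_ (h f _ (by positivity) ih)⟩
      rw [pow_succ 2 n, ← div_div]
      nlinarith
  obtain ⟨n, hn⟩ := pow_unbounded_of_one_lt (s / (q - L)) one_lt_two
  refine H.isNorm.mono ?_ (step n)
  rw [div_lt_iff₀ (sub_pos.2 hq)] at hn
  have : s / 2 ^ n ≤ q - L := by
    rw [div_le_iff₀ (by positivity)]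
    linarith
  linarith

end PreHilbertModule

end ToposHilbert

namespace ToposHilbert

variable {C : Type u} [SmallCategory C] {J : GrothendieckTopology C}

open ModuleOver

open ToposHilbert.CStarCategoryObject hiding star

/-! ### Commutativity of the complex numbers -/

section Comm

variable {U : C}

theorem DReal.MulBox.swap {x y : DReal J U} {V : C} {f : V ⟶ U} {P : ℚ → Prop}
    (h : DReal.MulBox x y f P) : DReal.MulBox y x f P := by
  obtain ⟨a, b, c, d, h1, h2, h3, h4, h5, h6, h7, h8⟩ := h
  exact ⟨c, d, a, b, h3, h4, h1, h2, mul_comm a c ▸ h5, mul_comm b c ▸ h7, mul_comm a d ▸ h6,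
    mul_comm b d ▸ h8⟩

theorem DReal.mul_comm (x y : DReal J U) : x.mul y = y.mul x := by
  ext q V f
  · exact ⟨fun h => Locally.mono h fun _ _ h => h.swap, fun h => Locally.mono h fun _ _ h => h.swap⟩
  · exact ⟨fun h => Locally.mono h fun _ _ h => h.swap, fun h => Locally.mono h fun _ _ h => h.swap⟩

theorem DReal.add_comm (x y : DReal J U) : x.add y = y.add x := by
  have lo : ∀ (x y : DReal J U) (q : ℚ) (V : C) (f : V ⟶ U), ((x.add y).lo q).arrows f →
      ((y.add x).lo q).arrows f := fun x y q V f h =>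
    Locally.mono h fun _ _ ⟨a, b, h1, h2, h3⟩ => ⟨b, a, by linarith, h3, h2⟩
  have up : ∀ (x y : DReal J U) (q : ℚ) (V : C) (f : V ⟶ U), ((x.add y).up q).arrows f →
      ((y.add x).up q).arrows f := fun x y q V f h =>
    Locally.mono h fun _ _ ⟨a, b, h1, h2, h3⟩ => ⟨b, a, by linarith, h3, h2⟩
  ext q V f
  · exact ⟨lo x y q V f, lo y x q V f⟩
  · exact ⟨up x y q V f, up y x q V f⟩

theorem DComplex.mul_comm (z w : DComplex J U) : z.mul w = w.mul z := by
  simp only [DComplex.mul, DReal.mul_comm w.re, DReal.mul_comm w.im]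
  rw [DReal.add_comm (z.re.mul w.im)]

/-- Needed for an external multiple of a natural transformation to be linear over the internal
complex numbers. -/
theorem ModuleOver.smul_smul_comm {X : Sheaf J (Type u)} {M : ModuleOver X} {x : Sec X U}
    (z w : DComplex J U) (a : M.El x) : M.smul z (M.smul w a) = M.smul w (M.smul z a) := by
  rw [← M.mul_smul, DComplex.mul_comm, M.mul_smul]

end Comm

/-! ### Natural transformations of Hilbert modules: norms, adjoints and limits -/

variable {𝔄 : CStarCategoryObject J}

theorem CStarCategoryObject.IsPositive.eq_zero_of_add_eq_zero {U : C} {a : Sec 𝔄.Ob U}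
    {t v : 𝔄.Mor a a} (ht : IsPositive t) (hv : IsPositive v) (h : t + v = 0) : v = 0 := by
  refine Fib.eq_of_locally (((EndAlg.exists_of_isPositive ht).and
    (EndAlg.exists_of_isPositive hv)).mono fun V f ⟨⟨k, hk⟩, ⟨l, hl⟩⟩ => ?_)
  have h1 : Mor.restrict f t + Mor.restrict f v = 0 := by
    have e := El.pull_add (M := 𝔄.mor.toModuleOver) f (res_pair f a a) t v
    rw [h, El.pull_zero (M := 𝔄.mor.toModuleOver)] at e
    exact e.symm
  rw [hk, hl] at h1
  have h2 : Mor.restrict f v = 0 := by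
    rw [hl, eq_zero_of_star_mul_self_add_star_mul_self (EndAlg.ext h1), mul_zero, EndAlg.val_zero]
  exact h2.trans (El.pull_zero (M := 𝔄.mor.toModuleOver) f (res_pair f a a)).symm

namespace HilbertModule

variable {H : HilbertModule 𝔄} {U : C} {a : Sec 𝔄.Ob U}

theorem eq_zero_of_inner_self {x : H.El a} (h : H.inner x x = 0) : x = 0 :=
  H.separated _ _ fun q hq => ⟨.of_forall fun _ _ => hq, by
    rw [h]; exact 𝔄.mor.isNorm.zero (by positivity)⟩

theorem ext_inner {x y : H.El a} (h : ∀ z : H.El a, H.inner z x = H.inner z y) : x = y := by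
  rw [← sub_eq_zero]
  refine eq_zero_of_inner_self ?_
  rw [H.inner_sub, h, sub_self]

end HilbertModule

namespace NatMap

variable {H G : HilbertModule 𝔄} {U : C}

@[ext]
theorem ext {f g : NatMap H G} (h : ∀ (U : C) (a : Sec 𝔄.Ob U) (x : H.El a), f.app x = g.app x) :
    f = g := by
  obtain ⟨f, _, _, _, _⟩ := f
  obtain ⟨g, _, _, _, _⟩ := g
  have : @f = @g := by funext U a x; exact h U a x
  subst this
  rfl

theorem act_zero (G : HilbertModule 𝔄) {a b : Sec 𝔄.Ob U} (f : 𝔄.Mor b a) :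
    G.act (0 : G.El a) f = 0 := by
  have := G.add_act (0 : G.El a) 0 f
  rw [add_zero] at this
  exact left_eq_add.1 this

theorem act_sub (G : HilbertModule 𝔄) {a b : Sec 𝔄.Ob U} (x y : G.El a) (f : 𝔄.Mor b a) :
    G.act (x - y) f = G.act x f - G.act y f := by
  rw [eq_sub_iff_add_eq, ← G.add_act, sub_add_cancel]

theorem app_zero (f : NatMap H G) {a : Sec 𝔄.Ob U} : f.app (0 : H.El a) = 0 := by
  have := f.app_add (0 : H.El a) 0
  rw [add_zero] at this
  exact left_eq_add.1 this

instance : Zero (NatMap H G) where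
  zero :=
    { app := fun _ => 0
      app_pull := fun k _ _ => El.pull_zero (M := G.toModuleOver) k rfl
      app_add := fun _ _ => (add_zero 0).symm
      app_smul := fun _ _ => (smul_zero_right _).symm
      app_act := fun _ _ => (act_zero G _).symm }

instance : Add (NatMap H G) where
  add f g :=
    { app := fun x => f.app x + g.app x
      app_pull := fun k _ x => by
        rw [El.pull_add (M := G.toModuleOver), f.app_pull, g.app_pull]
      app_add := fun x y => by rw [f.app_add, g.app_add, add_add_add_comm]
      app_smul := fun z x => by rw [f.app_smul, g.app_smul, G.smul_add]
      app_act := fun x m => by rw [f.app_act, g.app_act, G.add_act] }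

noncomputable instance : SMul ℂ (NatMap H G) where
  smul z f :=
    { app := fun x => z • f.app x
      app_pull := fun k _ x => by rw [El.pull_const_smul (M := G.toModuleOver), f.app_pull]
      app_add := fun x y => by rw [f.app_add, _root_.smul_add]
      app_smul := fun w x => by
        rw [f.app_smul]
        exact smul_smul_comm _ _ _
      app_act := fun x m => by
        rw [f.app_act]
        exact (G.smul_act _ _ _).symm }

theorem add_app (f g : NatMap H G) {a : Sec 𝔄.Ob U} (x : H.El a) :
    (f + g).app x = f.app x + g.app x := rfl

theorem smul_app (z : ℂ) (f : NatMap H G) {a : Sec 𝔄.Ob U} (x : H.El a) :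
    (z • f).app x = z • f.app x := rfl

theorem BoundedBy.mono {f : NatMap H G} {k l : ℚ} (hkl : k ≤ l) (h : f.BoundedBy U k) :
    f.BoundedBy U l := fun V p a x r hx => G.isNorm.glue _ _ (hx.1.mono fun W g hr =>
      G.isNorm.mono (by gcongr) (G.isNorm.pull g _ _ (h p x r hx)))

theorem NormLT.mono {f : NatMap H G} {k l : ℚ} (hkl : k ≤ l) (h : f.NormLT U k) :
    f.NormLT U l := Locally.mono h fun _ _ ⟨c, h0, h1, h2⟩ => ⟨c, h0, h1.trans_le hkl, h2⟩

theorem NormLT.boundedBy {f : NatMap H G} {q : ℚ} (h : f.NormLT U q) : f.BoundedBy U q := by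
  intro V p a x r hx
  refine G.isNorm.glue _ _ ((Locally.pullback h p).mono fun W g ⟨k, _, hk, h'⟩ => ?_)
  rw [f.app_pull]
  exact h'.mono hk.le (𝟙 W) _ r (H.isNorm.pull g _ _ hx)

theorem BoundedBy.normLT {f : NatMap H G} {k q : ℚ} (h : f.BoundedBy U k) (hk : 0 < k)
    (hq : k < q) : f.NormLT U q :=
  .of_forall fun _ p => ⟨k, hk, hq, fun _ p' => h (p' ≫ p)⟩

theorem NormLT.add {f g : NatMap H G} {q r : ℚ} (hf : f.NormLT U q) (hg : g.NormLT U r) :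
    (f + g).NormLT U (q + r) :=
  (Locally.and hf hg).mono fun _ _ ⟨⟨k, k0, k1, k2⟩, ⟨l, l0, l1, l2⟩⟩ =>
    ⟨k + l, add_pos k0 l0, add_lt_add k1 l1, fun _ p _ x t hx => by
      rw [add_mul]; exact G.isNorm.add (k2 p x t hx) (l2 p x t hx)⟩

theorem NormLT.smul {f : NatMap H G} {z : ℂ} {q r : ℚ} (hz : ‖z‖ < r) (hf : f.NormLT U q) :
    (z • f).NormLT U (r * q) := by
  have hr : 0 < r := by exact_mod_cast (norm_nonneg z).trans_lt hz
  exact Locally.mono hf fun _ _ ⟨k, k0, k1, k2⟩ =>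
    ⟨r * k, mul_pos hr k0, mul_lt_mul_of_pos_left k1 hr, fun _ p _ x t hx => by
      rw [mul_assoc]; exact G.isNorm.const_smul hz (k2 p x t hx)⟩

theorem normLT_zero {q : ℚ} (hq : 0 < q) : (0 : NatMap H G).NormLT U q := by
  refine .of_forall fun _ _ => ⟨q / 2, half_pos hq, half_lt_self hq, fun _ _ _ x t hx => ?_⟩
  refine G.isNorm.glue _ _ (hx.1.mono fun W g ht => ?_)
  exact G.isNorm.pull g _ _ (G.isNorm.zero (by positivity))

/-- The adjunction relation between two natural transformations. -/
def IsAdjoint (f : NatMap H G) (g : NatMap G H) : Prop :=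
  ∀ ⦃U : C⦄ ⦃a b : Sec 𝔄.Ob U⦄ (x : H.El a) (y : G.El b),
    H.inner x (g.app y) = G.inner (f.app x) y

theorem IsAdjoint.symm {f : NatMap H G} {g : NatMap G H} (h : f.IsAdjoint g) : g.IsAdjoint f := by
  intro U a b y x
  rw [G.inner_symm, ← h, ← H.inner_symm]

/-- By Cauchy-Schwarz `‖g y‖² = ‖⟨f g y, y⟩‖ ≤ k ‖g y‖ ‖y‖`, and `nlt_of_sq_le` cancels the factor
`‖g y‖` at the cost of enlarging `k` to `l`. -/
theorem IsAdjoint.boundedBy {f : NatMap H G} {g : NatMap G H} (h : f.IsAdjoint g) {k l : ℚ}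
    (hk : 0 < k) (hkl : k < l) (hf : f.BoundedBy U k) : g.BoundedBy U l := by
  intro V p a y r hy
  refine H.isNorm.glue _ _ (hy.1.mono fun W m hr => ?_)
  rw [g.app_pull]
  have hy' := G.isNorm.pull m _ _ hy
  refine H.nlt_of_sq_le (mul_pos hk hr) (fun Z t s hs hs' => ?_) (mul_lt_mul_of_pos_right hkl hr)
  rw [g.app_pull, h]
  rw [g.app_pull] at hs'
  have := G.nlt_inner (hf (t ≫ m ≫ p) _ s hs') (G.isNorm.pull t _ _ hy')
  rwa [mul_right_comm] at this

theorem IsAdjoint.normLT {f : NatMap H G} {g : NatMap G H} (h : f.IsAdjoint g) {q : ℚ}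
    (hf : f.NormLT U q) : g.NormLT U q :=
  Locally.mono hf fun _ _ ⟨k, k0, k1, k2⟩ =>
    ⟨(k + q) / 2, by linarith, by linarith, h.boundedBy k0 (by linarith) k2⟩

theorem IsAdjoint.normLT_of_comp {f : NatMap H G} {g : NatMap G H} (h : f.IsAdjoint g) {r : ℚ}
    (hr : 0 < r) (hf : (g.comp f).NormLT U (r ^ 2)) : f.NormLT U r := by
  refine Locally.mono hf fun V _ ⟨k, k0, k1, k2⟩ => ?_
  have hk : k / r < r := by rw [div_lt_iff₀ hr]; linarith
  -- `‖f x‖² = ‖⟨x, g f x⟩‖ ≤ k ‖x‖²` calls for a rational below `r` whose square is at least `k`.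
  -- The mean of `k / r` and `r` is one, by the arithmetic-geometric inequality, so no square root
  -- of `k` is needed.
  refine ⟨(k / r + r) / 2, by positivity, by linarith, fun W p a x t hx => ?_⟩
  refine ⟨hx.1.mono fun _ _ ht => by positivity, ?_⟩
  rw [← h]
  refine 𝔄.mor.isNorm.mono ?_ (H.nlt_inner hx (k2 p x t hx))
  have h1 : k ≤ ((k / r + r) / 2) ^ 2 := by
    have : k = k / r * r := by field_simp
    nlinarith [sq_nonneg (k / r - r)]
  nlinarith [sq_nonneg t]

theorem isBounded_of_normLT {f : NatMap H G} {q : ℚ} (h : ∀ U, f.NormLT U q) : f.IsBounded :=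
  fun _ => .of_forall fun V _ => ⟨q, h V⟩

/-- Norm convergence of a sequence of natural transformations. -/
def TendsTo (f : ℕ → NatMap H G) (F : NatMap H G) : Prop :=
  ∀ ε : ℚ, 0 < ε → ∃ N, ∀ n, N ≤ n → ∀ ⦃U : C⦄ ⦃a : Sec 𝔄.Ob U⦄ (x : H.El a) (r : ℚ),
    H.nlt x r → G.nlt ((f n).app x - F.app x) (ε * r)

/-- The limit is taken pointwise, and each algebraic identity passes to it by uniqueness of limits;
for the action of `𝔄` this uses that a morphism is locally bounded. -/
theorem exists_tendsTo (f : ℕ → NatMap H G)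
    (hf : ∀ ε : ℚ, 0 < ε → ∃ N, ∀ n m, N ≤ n → N ≤ m → ∀ ⦃U : C⦄ ⦃a : Sec 𝔄.Ob U⦄ (x : H.El a)
      (r : ℚ), H.nlt x r → G.nlt ((f n).app x - (f m).app x) (ε * r)) :
    ∃ F, TendsTo f F := by
  have N := G.isNorm
  choose F hF using fun (U : C) (a : Sec 𝔄.Ob U) (x : H.El a) =>
    ModuleOver.exists_locLim (s := fun n => (f n).app x) N G.separated G.complete
      ((H.isNorm.bounded' x).mono fun V p ⟨r, hr, hx⟩ ε hε => by
        obtain ⟨M, hM⟩ := hf (ε / r) (div_pos hε hr)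
        refine ⟨M, fun n m hn hm => ?_⟩
        have := hM n m hn hm _ r hx
        rwa [div_mul_cancel₀ _ hr.ne', ← app_pull, ← app_pull] at this)
  refine ⟨⟨fun {U a} x => F U a x, fun {V U} k a x => ?_, fun {U a} x y => ?_,
    fun {U a} z x => ?_, fun {U a b} x m => ?_⟩, fun ε hε => ?_⟩
  · refine LocLim.unique N G.separated ((hF U a x).pull k) ?_
    simpa only [app_pull] using hF V _ (x.pull k rfl)
  · refine LocLim.unique N G.separated (hF U a (x + y)) ?_
    simpa only [app_add] using (hF U a x).add N (hF U a y)
  · refine LocLim.unique N G.separated (hF U a (H.smul z x)) ?_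
    simpa only [app_smul] using (hF U a x).smul N z
  · refine LocLim.unique N G.separated (hF U b (H.act x m)) ?_
    simp only [app_act]
    refine (Locally.and (hF U a x) (𝔄.mor.isNorm.bounded' m)).mono
      fun V k ⟨h1, r, hr, h2⟩ ε hε => ?_
    obtain ⟨M, hM⟩ := h1 (ε / r) (div_pos hε hr)
    refine ⟨M, fun n hn => ?_⟩
    have := G.nlt_act (f := Mor.restrict k m) (hM n hn) hr h2
    rwa [div_mul_cancel₀ _ hr.ne', act_sub, ← G.act_pull, ← G.act_pull] at this
  · obtain ⟨M, hM⟩ := hf (ε / 2) (half_pos hε)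
    refine ⟨M, fun n hn U a x r hx => ?_⟩
    refine N.glue _ _ (hx.1.mono fun V p hr => ?_)
    refine N.pull p _ _ ((hF U a x).nlt_sub N (δ := ε / 2 * r) (by
      gcongr; exact half_lt_self hε) (N := M) fun m hm => hM n m hn hm x r hx)

/-- For `x` and `y` over the same object this is continuity of the scalar product, by
Cauchy-Schwarz. As `nlt_inner` covers only that case, distinct objects are reduced to it. -/
theorem isAdjoint_of_tendsTo {f : ℕ → NatMap H G} {g : ℕ → NatMap G H} {F : NatMap H G}
    {F' : NatMap G H} (h : ∀ n, (f n).IsAdjoint (g n)) (hf : TendsTo f F) (hg : TendsTo g F') :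
    F.IsAdjoint F' := by
  have N := 𝔄.mor.isNorm
  have key : ∀ {U : C} {a : Sec 𝔄.Ob U} (x : H.El a) (y : G.El a),
      H.inner x (F'.app y) - G.inner (F.app x) y = 0 := by
    intro U a x y
    refine 𝔄.mor.separated _ _ fun q hq => N.glue _ _ ?_
    refine ((H.isNorm.bounded' x).and (G.isNorm.bounded' y)).mono
      fun V p ⟨⟨r, hr, hx⟩, ⟨t, ht, hy⟩⟩ => ?_
    obtain ⟨n, hn⟩ := hf (q / (4 * r * t)) (by positivity)
    obtain ⟨m, hm⟩ := hg (q / (4 * r * t)) (by positivity)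
    have h1 := G.nlt_inner (hn (max n m) (le_max_left _ _) _ _ hx) hy
    have h2 := H.nlt_inner hx (hm (max n m) (le_max_right _ _) _ _ hy)
    rw [G.sub_inner, ← h] at h1
    rw [H.inner_sub] at h2
    have e1 : q / (4 * r * t) * r * t = q / 4 := by field_simp
    have e2 : r * (q / (4 * r * t) * t) = q / 4 := by field_simp
    rw [e1] at h1
    rw [e2] at h2
    have h3 := N.add (N.sub_comm h2 (q / 2) (by linarith)) h1
    rw [sub_add_sub_cancel] at h3
    have e3 : Fib.pull p rfl (H.inner x (F'.app y) - G.inner (F.app x) y) =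
        H.inner (x.pull p rfl) (F'.app (y.pull p rfl)) -
          G.inner (F.app (x.pull p rfl)) (y.pull p rfl) := by
      rw [El.pull_sub (M := 𝔄.mor.toModuleOver), H.inner_pull_self, G.inner_pull_self,
        F'.app_pull, F.app_pull]
      rfl
    rw [e3]
    exact N.mono (by linarith) h3
  intro U a b x y
  rw [← sub_eq_zero]
  -- Moving `y` to the object of `x` by the action of `D^*` turns the defect into `D D^*`, which
  -- vanishes by the first case; the `C*`-identity then gives `D = 0`.
  generalize hD : H.inner x (F'.app y) - G.inner (F.app x) y = D
  have h1 : 𝔄.comp (𝔄.star (𝔄.star D)) (𝔄.star D) = 0 := by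
    have := key x (G.act y (𝔄.star D))
    rw [F'.app_act, H.inner_act, G.inner_act, ← sub_comp, hD] at this
    rw [𝔄.star_star, this]
  refine 𝔄.mor.separated _ _ fun q hq => (𝔄.nlt_star D q).1 ((𝔄.nlt_star_comp_self _ q hq).1 ?_)
  rw [h1]
  exact N.zero (by positivity)

end NatMap

/-! ### The Banach space of globally bounded operators -/

namespace GlobalOperator

variable {H G : HilbertModule 𝔄} {U : C}

/-- A globally bounded operator from an adjoint pair, the first member of which is globally
bounded. -/
def ofAdjoint (f : NatMap H G) (g : NatMap G H) (h : f.IsAdjoint g)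
    (hf : ∃ q : ℚ, 0 < q ∧ ∀ U : C, f.NormLT U q) : GlobalOperator H G where
  toMap := f
  adj := g
  isBounded := NatMap.isBounded_of_normLT hf.choose_spec.2
  adj_isBounded := NatMap.isBounded_of_normLT fun U => h.normLT (hf.choose_spec.2 U)
  inner_adj x y := h x y
  globallyBounded := hf

theorem isAdjoint (f : GlobalOperator H G) : f.toMap.IsAdjoint f.adj :=
  fun _ _ _ => f.inner_adj

@[ext]
-- The adjoint is determined by the operator, because a Hilbert module is separated.
theorem ext {f g : GlobalOperator H G}
    (h : ∀ (U : C) (a : Sec 𝔄.Ob U) (x : H.El a), f.toMap.app x = g.toMap.app x) : f = g := by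
  have h1 : f.toMap = g.toMap := NatMap.ext h
  have h2 : f.adj = g.adj := by
    ext U a y
    refine HilbertModule.ext_inner fun z => ?_
    rw [f.inner_adj, g.inner_adj, h]
  obtain ⟨f, f', _, _, _, _⟩ := f
  obtain ⟨g, g', _, _, _, _⟩ := g
  obtain rfl : f = g := h1
  obtain rfl : f' = g' := h2
  rfl

/-- The relation `‖f‖ < q` internally, for globally bounded operators. -/
def LT (f : GlobalOperator H G) (q : ℚ) : Prop := ∀ U : C, f.toMap.NormLT U q

/-- The adjoint operator. -/
def dagger (f : GlobalOperator H G) : GlobalOperator G H :=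
  ofAdjoint f.adj f.toMap f.isAdjoint.symm (by
    obtain ⟨q, hq, h⟩ := f.globallyBounded
    exact ⟨q, hq, fun U => f.isAdjoint.normLT (h U)⟩)

theorem LT.dagger {f : GlobalOperator H G} {q : ℚ} (h : f.LT q) : f.dagger.LT q :=
  fun U => f.isAdjoint.normLT (h U)

scoped instance : Zero (GlobalOperator H G) where
  zero := ofAdjoint 0 0 (fun _ _ _ x y => by
    change H.inner x 0 = G.inner 0 y
    rw [← sub_self (0 : H.El _), H.inner_sub, sub_self, ← sub_self (0 : G.El _), G.sub_inner,
      sub_self]) ⟨1, one_pos, fun _ => NatMap.normLT_zero one_pos⟩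

scoped instance : Add (GlobalOperator H G) where
  add f g := ofAdjoint (f.toMap + g.toMap) (f.adj + g.adj) (fun _ _ _ x y => by
    rw [NatMap.add_app, NatMap.add_app, H.inner_add, G.add_inner, f.inner_adj, g.inner_adj]) (by
      obtain ⟨q, hq, h⟩ := f.globallyBounded
      obtain ⟨r, hr, h'⟩ := g.globallyBounded
      exact ⟨q + r, add_pos hq hr, fun U => (h U).add (h' U)⟩)

noncomputable scoped instance : SMul ℂ (GlobalOperator H G) where
  smul z f := ofAdjoint (z • f.toMap) ((starRingEnd ℂ) z • f.adj) (fun _ _ _ x y => by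
    rw [NatMap.smul_app, NatMap.smul_app, ← const_smul_eq, ← const_smul_eq, H.inner_smul,
      G.smul_inner, f.inner_adj, DComplex.const_conj]) (by
      obtain ⟨q, hq, h⟩ := f.globallyBounded
      obtain ⟨r, hr⟩ := exists_rat_gt ‖z‖
      have hr0 : 0 < r := by exact_mod_cast (norm_nonneg z).trans_lt hr
      exact ⟨r * q, mul_pos hr0 hq, fun U => (h U).smul hr⟩)

noncomputable scoped instance : Neg (GlobalOperator H G) where
  neg f := (-1 : ℂ) • f

theorem zero_app {a : Sec 𝔄.Ob U} (x : H.El a) : (0 : GlobalOperator H G).toMap.app x = 0 := rfl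

theorem add_app (f g : GlobalOperator H G) {a : Sec 𝔄.Ob U} (x : H.El a) :
    (f + g).toMap.app x = f.toMap.app x + g.toMap.app x := rfl

theorem neg_app (f : GlobalOperator H G) {a : Sec 𝔄.Ob U} (x : H.El a) :
    (-f).toMap.app x = -f.toMap.app x :=
  neg_one_smul ℂ (f.toMap.app x)

noncomputable scoped instance : AddCommGroup (GlobalOperator H G) where
  __ := AddGroup.ofLeftAxioms (G := GlobalOperator H G)
    (fun f g h => by ext U a x; exact add_assoc _ _ _)
    (fun f => by ext U a x; exact zero_add _)
    (fun f => by ext U a x; rw [add_app, neg_app, zero_app]; exact neg_add_cancel _)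
  add_comm f g := by ext U a x; exact add_comm _ _

theorem sub_app (f g : GlobalOperator H G) {a : Sec 𝔄.Ob U} (x : H.El a) :
    (f - g).toMap.app x = f.toMap.app x - g.toMap.app x := by
  rw [sub_eq_add_neg, add_app, neg_app, sub_eq_add_neg]

noncomputable scoped instance : Module ℂ (GlobalOperator H G) where
  one_smul f := by ext U a x; exact one_smul ℂ _
  mul_smul z w f := by ext U a x; exact mul_smul _ _ _
  smul_zero z := by ext U a x; exact smul_zero _
  smul_add z f g := by ext U a x; exact smul_add _ _ _
  add_smul z w f := by ext U a x; exact add_smul _ _ _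
  zero_smul f := by ext U a x; exact zero_smul ℂ _

theorem dagger_add (f g : GlobalOperator H G) : (f + g).dagger = f.dagger + g.dagger := by
  ext U a x; rfl

theorem dagger_smul (z : ℂ) (f : GlobalOperator H G) :
    (z • f).dagger = (starRingEnd ℂ) z • f.dagger := by
  ext U a x; rfl

theorem dagger_neg (f : GlobalOperator H G) : (-f).dagger = -f.dagger := by
  rw [← neg_one_smul ℂ, dagger_smul, map_neg, map_one, neg_one_smul]

theorem dagger_sub (f g : GlobalOperator H G) : (f - g).dagger = f.dagger - g.dagger := by
  rw [sub_eq_add_neg, dagger_add, dagger_neg, sub_eq_add_neg]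

theorem LT.nlt_app {f : GlobalOperator H G} {q r : ℚ} (h : f.LT q) {a : Sec 𝔄.Ob U} {x : H.El a}
    (hx : H.nlt x r) : G.nlt (f.toMap.app x) (q * r) :=
  (h U).boundedBy (𝟙 U) x r hx

/-- The adjoints of a Cauchy sequence are Cauchy at the same rate, so both sequences converge and
their limits form an adjoint pair. -/
theorem isRatGauge : IsRatGauge (LT (H := H) (G := G)) where
  bounded f := f.globallyBounded
  mono f q r _ hqr h U := (h U).mono hqr
  add f g q r _ _ h h' U := (h U).add (h' U)
  smul z r f q hz _ h U := (h U).smul hz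
  separated f h := by
    ext U a x
    refine G.separated _ _ fun q hq => G.isNorm.glue _ _ ?_
    refine (H.isNorm.bounded' x).mono fun V p ⟨r, hr, hx⟩ => ?_
    have := (h (q / r) (div_pos hq hr)).nlt_app hx
    rwa [div_mul_cancel₀ _ hr.ne', ← NatMap.app_pull] at this
  complete s hs := by
    obtain ⟨F, hF⟩ := NatMap.exists_tendsTo (fun n => (s n).toMap) fun ε hε =>
      (hs ε hε).imp fun N hN n m hn hm U a x r hx => by
        rw [← sub_app]; exact (hN n m hn hm).nlt_app hx
    obtain ⟨F', hF'⟩ := NatMap.exists_tendsTo (fun n => (s n).adj) fun ε hε =>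
      (hs ε hε).imp fun N hN n m hn hm U a x r hx => by
        have := (hN n m hn hm).dagger.nlt_app hx
        rwa [dagger_sub, sub_app] at this
    have hadj := NatMap.isAdjoint_of_tendsTo (fun n => (s n).isAdjoint) hF hF'
    obtain ⟨N, hN⟩ := hF 1 one_pos
    obtain ⟨K, hK, hK'⟩ := (s N).globallyBounded
    -- The triangle inequality gives the bound `2 + K`; the extra unit is there because `NormLT` is
    -- strict.
    refine ⟨ofAdjoint F F' hadj ⟨3 + K, by linarith, fun U => ?_⟩, fun ε hε => ?_⟩
    · refine NatMap.BoundedBy.normLT (k := 2 + K) (fun V p a x r hx => ?_) (by linarith)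
        (by linarith)
      refine G.isNorm.glue _ _ (hx.1.mono fun W m hr => G.isNorm.pull m _ _ ?_)
      have := G.isNorm.add (G.isNorm.sub_comm (hN N le_rfl x r hx) (2 * r) (by linarith))
        ((hK' V).boundedBy (𝟙 V) x r hx)
      rwa [sub_add_cancel, ← add_mul] at this
    · obtain ⟨N, hN⟩ := hF (ε / 2) (half_pos hε)
      refine ⟨N, fun n hn U => NatMap.BoundedBy.normLT (k := ε / 2) (fun V p a x r hx => ?_)
        (half_pos hε) (half_lt_self hε)⟩
      rw [sub_app]
      exact hN n hn x r hx

noncomputable scoped instance : NormedAddCommGroup (GlobalOperator H G) :=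
  isRatGauge.normedAddCommGroup

noncomputable scoped instance : NormedSpace ℂ (GlobalOperator H G) := isRatGauge.normedSpace

scoped instance : CompleteSpace (GlobalOperator H G) := isRatGauge.completeSpace

theorem norm_def (f : GlobalOperator H G) : ‖f‖ = gaugeNorm LT f := rfl

theorem norm_dagger (f : GlobalOperator H G) : ‖f.dagger‖ = ‖f‖ := by
  have : f.dagger.LT = f.LT := by
    funext q
    exact propext ⟨fun h => h.dagger, fun h => h.dagger⟩
  rw [norm_def, norm_def, gaugeNorm, gaugeNorm, this]

end GlobalOperator

/-! ### The `C*`-category of Hilbert modules -/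

namespace HilbertModule

open GlobalOperator

variable {H G K : HilbertModule 𝔄}

theorem norm_comp_le (f : H ⟶ G) (g : G ⟶ K) :
    ‖toOperator (f ≫ g)‖ ≤ ‖toOperator g‖ * ‖toOperator f‖ := by
  refine le_mul_of_forall_rat (norm_nonneg _) (norm_nonneg _) fun q r hq hr => ?_
  have hq0 : 0 < q := by exact_mod_cast (norm_nonneg (toOperator g)).trans_lt hq
  have hr0 : 0 < r := by exact_mod_cast (norm_nonneg (toOperator f)).trans_lt hr
  exact_mod_cast gaugeNorm_le (mul_pos hq0 hr0) fun U => NatMap.normLT_comp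
    (GlobalOperator.isRatGauge.lt_of_gaugeNorm_lt hq U)
    (GlobalOperator.isRatGauge.lt_of_gaugeNorm_lt hr U)

theorem norm_sq_le (h : H ⟶ G) :
    ‖toOperator h‖ ^ 2 ≤ ‖toOperator (h ≫ (toOperator h).dagger : H ⟶ H)‖ :=
  gaugeNorm_sq_le_gaugeNorm GlobalOperator.isRatGauge fun _ hr hlt U =>
    (toOperator h).isAdjoint.normLT_of_comp hr (hlt U)

theorem norm_sq_eq (h : H ⟶ G) :
    ‖toOperator h‖ ^ 2 = ‖toOperator (h ≫ (toOperator h).dagger : H ⟶ H)‖ := by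
  refine le_antisymm (norm_sq_le h) ((norm_comp_le _ _).trans ?_)
  rw [GlobalOperator.norm_dagger, sq]

theorem add_comp (f f' : H ⟶ G) (g : G ⟶ K) :
    (toOperator f + toOperator f' : H ⟶ G) ≫ g = toOperator (f ≫ g) + toOperator (f' ≫ g) :=
  GlobalOperator.ext fun _ _ _ => (toOperator g).toMap.app_add _ _

theorem comp_add (f : H ⟶ G) (g g' : G ⟶ K) :
    f ≫ (toOperator g + toOperator g' : G ⟶ K) = toOperator (f ≫ g) + toOperator (f ≫ g') :=
  GlobalOperator.ext fun _ _ _ => rfl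

theorem smul_comp (z : ℂ) (f : H ⟶ G) (g : G ⟶ K) :
    (z • toOperator f : H ⟶ G) ≫ g = z • toOperator (f ≫ g) :=
  GlobalOperator.ext fun _ _ _ => (toOperator g).toMap.app_smul _ _

theorem comp_smul (z : ℂ) (f : H ⟶ G) (g : G ⟶ K) :
    f ≫ (z • toOperator g : G ⟶ K) = z • toOperator (f ≫ g) :=
  GlobalOperator.ext fun _ _ _ => rfl

-- The product follows the order of operators, so that `star k * k` is `k ≫ k^*` in diagrammatic
-- order.
scoped instance : Mul (GlobalOperator H H) where
  mul f g := toOperator ((g : H ⟶ H) ≫ (f : H ⟶ H))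

scoped instance : Star (GlobalOperator H H) where
  star f := f.dagger

theorem mul_app (f g : GlobalOperator H H) {U : C} {a : Sec 𝔄.Ob U} (x : H.El a) :
    (f * g).toMap.app x = f.toMap.app (g.toMap.app x) := rfl

noncomputable scoped instance : NonUnitalNormedRing (GlobalOperator H H) where
  __ := (inferInstance : NormedAddCommGroup (GlobalOperator H H))
  left_distrib f g k := GlobalOperator.ext fun _ _ x => by
    simp only [mul_app, add_app, f.toMap.app_add]
  right_distrib f g k := GlobalOperator.ext fun _ _ x => by
    simp only [mul_app, add_app]
  zero_mul f := GlobalOperator.ext fun _ _ x => by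
    simp only [mul_app, zero_app]
  mul_zero f := GlobalOperator.ext fun _ _ x => by
    simp only [mul_app, zero_app, f.toMap.app_zero]
  mul_assoc f g k := GlobalOperator.ext fun _ _ x => by
    simp only [mul_app]
  norm_mul_le f g := norm_comp_le g f

scoped instance : StarRing (GlobalOperator H H) where
  star_involutive _ := rfl
  star_mul _ _ := GlobalOperator.ext fun _ _ _ => rfl
  star_add f g := dagger_add f g

noncomputable scoped instance : NonUnitalCStarAlgebra (GlobalOperator H H) where
  norm_mul_self_le f := by
    rw [← sq]
    exact norm_sq_le f
  smul_assoc z f g := comp_smul z g f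
  smul_comm z f g := (smul_comp z g f).symm
  star_smul z f := dagger_smul z f

/-- The compression criterion in the `C*`-algebra of endomorphisms of `H`: pairing `s h^* h s x +
c^* c x = 0` with `x` gives `⟨h s x, h s x⟩ + ⟨c x, c x⟩ = 0`. Both terms are internally positive,
so `c x = 0`. -/
theorem exists_comp_dagger_eq (h : H ⟶ G) : ∃ k : H ⟶ H,
    h ≫ ((toOperator h).dagger : G ⟶ H) = k ≫ ((toOperator k).dagger : H ⟶ H) := by
  let t : GlobalOperator H H := h ≫ ((toOperator h).dagger : G ⟶ H)
  have ht : IsSelfAdjoint t := GlobalOperator.ext fun _ _ _ => rfl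
  refine exists_star_mul_self_of_compressions (a := t) ht fun s c hs hc =>
    GlobalOperator.ext fun U a x => eq_zero_of_inner_self ?_
  have h1 : s * t * s + star c * c = 0 := by rw [hc, neg_add_cancel]
  have h2 : s.toMap.app ((toOperator h).adj.app ((toOperator h).toMap.app (s.toMap.app x))) +
      c.adj.app (c.toMap.app x) = 0 := congrArg (fun f : GlobalOperator H H => f.toMap.app x) h1
  have h3 : s.adj = s.toMap := congrArg GlobalOperator.toMap hs.star_eq
  rw [← h3] at h2
  have h4 := congrArg (H.inner x) h2
  rw [H.inner_add, s.inner_adj, c.inner_adj, (toOperator h).inner_adj, h3] at h4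
  refine IsPositive.eq_zero_of_add_eq_zero (G.inner_self_pos _) (H.inner_self_pos _)
    (h4.trans ?_)
  rw [← sub_self (0 : H.El a), H.inner_sub, sub_self]

noncomputable scoped instance cStarCategory : CStarCategory (HilbertModule 𝔄) where
  normedAddCommGroup H G := inferInstanceAs (NormedAddCommGroup (GlobalOperator H G))
  normedSpace H G := inferInstanceAs (NormedSpace ℂ (GlobalOperator H G))
  completeSpace H G := inferInstanceAs (CompleteSpace (GlobalOperator H G))
  add_comp := add_comp
  comp_add := comp_add
  smul_comp := smul_comp
  comp_smul := comp_smul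
  norm_comp_le := norm_comp_le
  dagger f := (toOperator f).dagger
  dagger_dagger _ := rfl
  dagger_id _ := GlobalOperator.ext fun _ _ _ => rfl
  dagger_comp _ _ := GlobalOperator.ext fun _ _ _ => rfl
  dagger_add := dagger_add
  dagger_smul := dagger_smul
  norm_dagger := norm_dagger
  norm_comp_dagger := norm_sq_eq
  comp_dagger_pos := exists_comp_dagger_eq

end HilbertModule

end ToposHilbert

theorem mainTheorem10 {C : Type u} [SmallCategory C]
    (J : GrothendieckTopology C) :
    (∀ (X : Sheaf J (Type u)) (B : BanachOver X),
      ∃ (_ : NormedAddCommGroup (BoundedSection B))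
        (_ : NormedSpace ℂ (BoundedSection B)),
        CompleteSpace (BoundedSection B) ∧
        (∀ (s t : BoundedSection B) (U : C) (x : Sec X U),
          (s + t).app x = s.app x + t.app x) ∧
        (∀ (z : ℂ) (s : BoundedSection B) (U : C) (x : Sec X U),
          (z • s).app x = B.smul (DComplex.const J U z) (s.app x)) ∧
        (∀ s : BoundedSection B, ‖s‖ = s.supNorm)) ∧
    (∀ 𝔄 : CStarCategoryObject J,
      ∃ _ : CStarCategory (HilbertModule 𝔄),
        (∀ (H G : HilbertModule 𝔄) (f g : H ⟶ G) (U : C)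
          (a : Sec 𝔄.Ob U) (x : H.El a),
          (toOperator (f + g)).toMap.app x =
            (toOperator f).toMap.app x + (toOperator g).toMap.app x) ∧
        (∀ (H G : HilbertModule 𝔄) (z : ℂ) (f : H ⟶ G) (U : C)
          (a : Sec 𝔄.Ob U) (x : H.El a),
          (toOperator (z • f)).toMap.app x =
            G.smul (DComplex.const J U z)
              ((toOperator f).toMap.app x)) ∧
        (∀ (H G : HilbertModule 𝔄) (f : H ⟶ G),
          (toOperator (CStarCategory.dagger f)).toMap =
            (toOperator f).adj) ∧
        (∀ (H G : HilbertModule 𝔄) (f : H ⟶ G),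
          ‖f‖ = (toOperator f).supNorm)) :=
  -- The norms were built as the same infima as `supNorm`, and the operations are pointwise, so the
  -- compatibility clauses hold definitionally.
  ⟨fun _ _ => open scoped ToposHilbert.BoundedSection in
    ⟨BoundedSection.isRatGauge.normedAddCommGroup, BoundedSection.isRatGauge.normedSpace,
    BoundedSection.isRatGauge.completeSpace, fun _ _ _ _ => rfl, fun _ _ _ _ => rfl,
    fun _ => rfl⟩, fun _ => ⟨HilbertModule.cStarCategory,
    fun _ _ _ _ _ _ _ => rfl, fun _ _ _ _ _ _ _ => rfl, fun _ _ _ => rfl, fun _ _ _ => rfl⟩⟩
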